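/- Operads are symmetric, in two colours $\mathfrak c$ ("closed", aerial) and $\mathfrak o$ ("open", terrestrial). An operad in groupoids has a groupoid in each arity and strictly associative, unital and equivariant functorial composition; a *categorical equivalence* is a morphism of operads in groupoids (a strict morphism, given by a functor in each arity) that is an equivalence of categories in each arity. *The Swiss-Cheese operad.* $\mathsf{SC}(n,m)$ ($n+m\ge 1$; output colour $\mathfrak o$, $n$ open and $m$ closed inputs) is the space of configurations, with disjoint interiors, of $n$ little half disks centred on the real line and $m$ little full disks in the unit upper half disk $D^+=\{z\in\mathbb C:\operatorname{Im}z\ge 0,\ |z|\le 1\}$. (So $\mathsf{SC}(0,m)\neq\varnothing$ for $m\ge1$.) With output colour $\mathfrak c$ all inputs must be closed, and the space is that of the little disks operad $\mathsf D_2(m)$, $m\ge 1$, with disks in the unit disk. Composition is composition of the embeddings, and $\pi\mathsf{SC}$ is the fundamental groupoid, an operad in groupoids. *The free operad.* Let $\Omega\Omega$ be the free two-coloured operad in sets on $\mu_{\mathfrak c}$ (two closed inputs, closed output), $f$ (one closed input, open output) and $\mu_{\mathfrak o}$ (two open inputs, open output). Let $i:\Omega\Omega\to\mathsf{SC}$ be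 the morphism sending $\mu_{\mathfrak c}$ (resp. $\mu_{\mathfrak o}$) to the two disks (resp. half disks) of radius $\frac12$ with centres $-\frac12$ and $\frac12$, in this order, and $f$ to the full disk of radius $\frac12$ with centre $\frac i2$. Let $\pi\mathsf{SC}_{|\Omega\Omega}\subset\pi\mathsf{SC}$ be the full suboperad on the objects in the image of $i$. *Coloured permutations and braids.* Let $\mathrm{Conf}(n,m)$ be the space of configurations of $n$ distinct points of the real interval $[-1,1]$ and $m$ distinct points of $D^+$ with positive imaginary part. For each left-to-right order of the $n+m$ labelled points choose a configuration with these points in this order, and let $C^0(n,m)$ be the set of these configurations. Then $\mathsf{CoPB}(n,m)$ is the full subgroupoid of the fundamental groupoid $\pi\mathrm{Conf}(n,m)$ on the objects $C^0(n,m)$. Together with the analogous groupoids of coloured braids (configurations of $m\geq1$ points in the unit disk) for the output colour $\mathfrak c$, these groupoids form an operad in groupoids $\mathsf{CoPB}$, where composition replaces, on objects, a point by an ordered family of points, and, on morphisms, inserts braids into tubular neighbourhoods of strands. *Parenthesized permutations and braids.* Let $\omega:\Omega\Omega\to\operatorname{ob}\mathsf{CoPB}$ be the morphism sending $\mu_{\mathfrak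 c}$ and $\mu_{\mathfrak o}$ to two points in the order $1,2$, and $f$ to a single point. Let $\mathsf{PaPB}=\omega^*\mathsf{CoPB}$: its operad of objects is $\Omega\Omega$ and $\operatorname{Hom}_{\mathsf{PaPB}}(u,v)=\operatorname{Hom}_{\mathsf{CoPB}}(\omega(u),\omega(v))$. **Theorem.** The morphism $i:\Omega\Omega\to\mathsf{SC}$ is injective, and there is an isomorphism of operads in groupoids $\pi\mathsf{SC}_{|\Omega\Omega}\cong\mathsf{PaPB}$ which is the identity of $\Omega\Omega$ on objects (that is, it sends $i(u)$ to $u$). The inclusion $\pi\mathsf{SC}_{|\Omega\Omega}\to\pi\mathsf{SC}$ and the canonical morphism $\mathsf{PaPB}\to\mathsf{CoPB}$ are categorical equivalences, so that there is a zigzag of categorical equivalences $$\pi\mathsf{SC}\xleftarrow{\ \sim\ }\pi\mathsf{SC}_{|\Omega\Omega}\cong\mathsf{PaPB}\xrightarrow{\ \sim\ }\mathsf{CoPB}.$$ -/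

import Mathlib

open CategoryTheory

namespace SwissCheese

/-! ## Two-coloured symmetric operads -/

/-- The two colours: `c` (closed, aerial) and `o` (open, terrestrial). -/
inductive Col
  | c
  | o

/-- Symmetric operads in sets with colours `Col`, in coordinate-free form: operations have their
inputs indexed by an arbitrary finite set `X`, with colours `χ : X → Col`, and one output of
colour `k`. Bijections relabel inputs (for `X = Fin n` this is the action of permutations). -/
structure SetOperad where
  /-- Operations with inputs `X` coloured by `χ`, and output colour `k`. -/
  Op (X : Type) [Finite X] (χ : X → Col) (k : Col) : Type
  /-- Relabelling of the inputs along a bijection. -/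
  relabel {X X' : Type} [Finite X] [Finite X'] (e : X ≃ X') {χ : X' → Col} {k : Col} :
    Op X (χ ∘ e) k → Op X' χ k
  /-- The identity operations. -/
  one (k : Col) : Op Unit (fun _ => k) k
  /-- Full operadic composition: plug `q y` into the input `y` of `p`. -/
  comp {Y : Type} [Finite Y] {X : Y → Type} [∀ y, Finite (X y)] {χ : Y → Col}
    {ξ : ∀ y, X y → Col} {k : Col} :
    Op Y χ k → (∀ y, Op (X y) (ξ y) (χ y)) → Op (Σ y, X y) (fun p => ξ p.1 p.2) k
  relabel_refl {X : Type} [Finite X] {χ : X → Col} {k : Col} (p : Op X χ k) :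
    relabel (Equiv.refl X) p = p
  relabel_trans {X X' X'' : Type} [Finite X] [Finite X'] [Finite X''] (e : X ≃ X') (e' : X' ≃ X'')
    {χ : X'' → Col} {k : Col} (p : Op X ((χ ∘ e') ∘ e) k) :
    relabel (χ := χ) (e.trans e') p = relabel e' (relabel e p)
  one_comp {X : Type} [Finite X] {χ : X → Col} {k : Col} (p : Op X χ k) :
    relabel (Equiv.uniqueSigma fun _ : Unit => X) (comp (one k) fun _ => p) = p
  comp_one {X : Type} [Finite X] {χ : X → Col} {k : Col} (p : Op X χ k) :
    relabel (Equiv.sigmaUnique X fun _ => Unit) (comp p fun x => one (χ x)) = p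
  assoc {Y : Type} [Finite Y] {X : Y → Type} [∀ y, Finite (X y)]
    {Z : ∀ y, X y → Type} [∀ y x, Finite (Z y x)] {χ : Y → Col} {ξ : ∀ y, X y → Col}
    {ζ : ∀ y x, Z y x → Col} {k : Col} (p : Op Y χ k) (q : ∀ y, Op (X y) (ξ y) (χ y))
    (r : ∀ y x, Op (Z y x) (ζ y x) (ξ y x)) :
    relabel (χ := fun v : (Σ y, Σ x, Z y x) => ζ v.1 v.2.1 v.2.2) (Equiv.sigmaAssoc Z)
        (comp (comp p q) fun w : (Σ y, X y) => r w.1 w.2) =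
      comp p fun y => comp (q y) fun x => r y x
  comp_relabel {Y : Type} [Finite Y] {X X' : Y → Type} [∀ y, Finite (X y)] [∀ y, Finite (X' y)]
    (e : ∀ y, X y ≃ X' y) {χ : Y → Col} {ξ : ∀ y, X' y → Col} {k : Col} (p : Op Y χ k)
    (q : ∀ y, Op (X y) (ξ y ∘ e y) (χ y)) :
    comp p (fun y => relabel (e y) (q y)) =
      relabel (χ := fun v : (Σ y, X' y) => ξ v.1 v.2) (Equiv.sigmaCongrRight e) (comp p q)
  relabel_comp {Y Y' : Type} [Finite Y] [Finite Y'] (e : Y ≃ Y') {X : Y' → Type}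
    [∀ y, Finite (X y)] {χ : Y' → Col} {ξ : ∀ y, X y → Col} {k : Col} (p : Op Y (χ ∘ e) k)
    (q : ∀ y, Op (X y) (ξ y) (χ y)) :
    comp (relabel e p) q =
      relabel (χ := fun v : (Σ y, X y) => ξ v.1 v.2) (Equiv.sigmaCongrLeft e)
        (comp p fun y => q (e y))

/-- Morphisms of operads in sets. -/
structure SetOperad.Hom (P Q : SetOperad) where
  /-- The map on operations. -/
  obj {X : Type} [Finite X] {χ : X → Col} {k : Col} : P.Op X χ k → Q.Op X χ k
  obj_relabel {X X' : Type} [Finite X] [Finite X'] (e : X ≃ X') {χ : X' → Col} {k : Col}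
    (p : P.Op X (χ ∘ e) k) : obj (P.relabel e p) = Q.relabel e (obj p)
  obj_one (k : Col) : obj (P.one k) = Q.one k
  obj_comp {Y : Type} [Finite Y] {X : Y → Type} [∀ y, Finite (X y)] {χ : Y → Col}
    {ξ : ∀ y, X y → Col} {k : Col} (p : P.Op Y χ k) (q : ∀ y, P.Op (X y) (ξ y) (χ y)) :
    obj (P.comp p q) = Q.comp (obj p) fun y => obj (q y)

/-- Two-coloured symmetric operads in groupoids: the operations of each arity are the objects of a
groupoid, relabelling and composition are functors, and the axioms of operads hold strictly.
(Equality in the type of arrows is equality of sources, of targets and of morphisms.) -/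
structure GrpdOperad extends SetOperad where
  /-- The groupoid of operations of a given arity. -/
  grpd (X : Type) [Finite X] (χ : X → Col) (k : Col) : Groupoid (Op X χ k)
  /-- Relabelling of morphisms. -/
  relabelMap {X X' : Type} [Finite X] [Finite X'] (e : X ≃ X') {χ : X' → Col} {k : Col}
    {p p' : Op X (χ ∘ e) k} : (p ⟶ p') → (relabel e p ⟶ relabel e p')
  /-- Operadic composition of morphisms. -/
  compMap {Y : Type} [Finite Y] {X : Y → Type} [∀ y, Finite (X y)] {χ : Y → Col}
    {ξ : ∀ y, X y → Col} {k : Col} {p p' : Op Y χ k} {q q' : ∀ y, Op (X y) (ξ y) (χ y)} :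
    (p ⟶ p') → (∀ y, q y ⟶ q' y) → (comp p q ⟶ comp p' q')
  relabelMap_id {X X' : Type} [Finite X] [Finite X'] (e : X ≃ X') {χ : X' → Col} {k : Col}
    (p : Op X (χ ∘ e) k) : relabelMap e (𝟙 p) = 𝟙 (relabel e p)
  relabelMap_comp {X X' : Type} [Finite X] [Finite X'] (e : X ≃ X') {χ : X' → Col} {k : Col}
    {p p' p'' : Op X (χ ∘ e) k} (f : p ⟶ p') (g : p' ⟶ p'') :
    relabelMap e (f ≫ g) = relabelMap e f ≫ relabelMap e g
  compMap_id {Y : Type} [Finite Y] {X : Y → Type} [∀ y, Finite (X y)] {χ : Y → Col}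
    {ξ : ∀ y, X y → Col} {k : Col} (p : Op Y χ k) (q : ∀ y, Op (X y) (ξ y) (χ y)) :
    compMap (𝟙 p) (fun y => 𝟙 (q y)) = 𝟙 (comp p q)
  compMap_comp {Y : Type} [Finite Y] {X : Y → Type} [∀ y, Finite (X y)] {χ : Y → Col}
    {ξ : ∀ y, X y → Col} {k : Col} {p p' p'' : Op Y χ k} {q q' q'' : ∀ y, Op (X y) (ξ y) (χ y)}
    (f : p ⟶ p') (f' : p' ⟶ p'') (g : ∀ y, q y ⟶ q' y) (g' : ∀ y, q' y ⟶ q'' y) :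
    compMap (f ≫ f') (fun y => g y ≫ g' y) = compMap f g ≫ compMap f' g'
  relabelMap_refl {X : Type} [Finite X] {χ : X → Col} {k : Col} {p p' : Op X χ k} (f : p ⟶ p') :
    Arrow.mk (relabelMap (χ := χ) (Equiv.refl X) f) = Arrow.mk f
  relabelMap_trans {X X' X'' : Type} [Finite X] [Finite X'] [Finite X''] (e : X ≃ X')
    (e' : X' ≃ X'') {χ : X'' → Col} {k : Col} {p p' : Op X ((χ ∘ e') ∘ e) k} (f : p ⟶ p') :
    Arrow.mk (relabelMap (χ := χ) (e.trans e') f) = Arrow.mk (relabelMap e' (relabelMap e f))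
  one_compMap {X : Type} [Finite X] {χ : X → Col} {k : Col} {p p' : Op X χ k} (f : p ⟶ p') :
    Arrow.mk (relabelMap (χ := χ) (Equiv.uniqueSigma fun _ : Unit => X)
      (compMap (𝟙 (one k)) fun _ => f)) = Arrow.mk f
  compMap_one {X : Type} [Finite X] {χ : X → Col} {k : Col} {p p' : Op X χ k} (f : p ⟶ p') :
    Arrow.mk (relabelMap (χ := χ) (Equiv.sigmaUnique X fun _ => Unit)
      (compMap f fun x => 𝟙 (one (χ x)))) = Arrow.mk f
  assocMap {Y : Type} [Finite Y] {X : Y → Type} [∀ y, Finite (X y)]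
    {Z : ∀ y, X y → Type} [∀ y x, Finite (Z y x)] {χ : Y → Col} {ξ : ∀ y, X y → Col}
    {ζ : ∀ y x, Z y x → Col} {k : Col} {p p' : Op Y χ k} {q q' : ∀ y, Op (X y) (ξ y) (χ y)}
    {r r' : ∀ y x, Op (Z y x) (ζ y x) (ξ y x)}
    (f : p ⟶ p') (g : ∀ y, q y ⟶ q' y) (h : ∀ y x, r y x ⟶ r' y x) :
    Arrow.mk (relabelMap (χ := fun v : (Σ y, Σ x, Z y x) => ζ v.1 v.2.1 v.2.2)
      (Equiv.sigmaAssoc Z) (compMap (compMap f g) fun w : (Σ y, X y) => h w.1 w.2)) =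
      Arrow.mk (compMap f fun y => compMap (g y) fun x => h y x)
  compMap_relabel {Y : Type} [Finite Y] {X X' : Y → Type} [∀ y, Finite (X y)]
    [∀ y, Finite (X' y)] (e : ∀ y, X y ≃ X' y) {χ : Y → Col} {ξ : ∀ y, X' y → Col} {k : Col}
    {p p' : Op Y χ k} {q q' : ∀ y, Op (X y) (ξ y ∘ e y) (χ y)}
    (f : p ⟶ p') (g : ∀ y, q y ⟶ q' y) :
    Arrow.mk (compMap f (fun y => relabelMap (e y) (g y))) =
      Arrow.mk (relabelMap (χ := fun v : (Σ y, X' y) => ξ v.1 v.2)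
        (Equiv.sigmaCongrRight e) (compMap f g))
  relabelMap_compMap {Y Y' : Type} [Finite Y] [Finite Y'] (e : Y ≃ Y') {X : Y' → Type}
    [∀ y, Finite (X y)] {χ : Y' → Col} {ξ : ∀ y, X y → Col} {k : Col} {p p' : Op Y (χ ∘ e) k}
    {q q' : ∀ y, Op (X y) (ξ y) (χ y)} (f : p ⟶ p') (g : ∀ y, q y ⟶ q' y) :
    Arrow.mk (compMap (relabelMap e f) g) =
      Arrow.mk (relabelMap (χ := fun v : (Σ y, X y) => ξ v.1 v.2)
        (Equiv.sigmaCongrLeft e) (compMap f fun y => g (e y)))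

attribute [instance] GrpdOperad.grpd

/-- Morphisms of operads in groupoids: a functor in each arity, compatible with relabelling,
identity operations and composition. -/
structure GrpdOperad.Hom (P Q : GrpdOperad) extends SetOperad.Hom P.toSetOperad Q.toSetOperad where
  /-- The action on morphisms. -/
  map {X : Type} [Finite X] {χ : X → Col} {k : Col} {p p' : P.Op X χ k} :
    (p ⟶ p') → (obj p ⟶ obj p')
  map_id {X : Type} [Finite X] {χ : X → Col} {k : Col} (p : P.Op X χ k) : map (𝟙 p) = 𝟙 (obj p)
  map_comp {X : Type} [Finite X] {χ : X → Col} {k : Col} {p p' p'' : P.Op X χ k}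
    (f : p ⟶ p') (g : p' ⟶ p'') : map (f ≫ g) = map f ≫ map g
  map_relabel {X X' : Type} [Finite X] [Finite X'] (e : X ≃ X') {χ : X' → Col} {k : Col}
    {p p' : P.Op X (χ ∘ e) k} (f : p ⟶ p') :
    Arrow.mk (map (P.relabelMap e f)) = Arrow.mk (Q.relabelMap e (map f))
  map_compMap {Y : Type} [Finite Y] {X : Y → Type} [∀ y, Finite (X y)] {χ : Y → Col}
    {ξ : ∀ y, X y → Col} {k : Col} {p p' : P.Op Y χ k} {q q' : ∀ y, P.Op (X y) (ξ y) (χ y)}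
    (f : p ⟶ p') (g : ∀ y, q y ⟶ q' y) :
    Arrow.mk (map (P.compMap f g)) = Arrow.mk (Q.compMap (map f) fun y => map (g y))

/-- The functor in a given arity underlying a morphism of operads in groupoids. -/
def GrpdOperad.Hom.functor {P Q : GrpdOperad} (F : P.Hom Q) (X : Type) [Finite X] (χ : X → Col)
    (k : Col) : P.Op X χ k ⥤ Q.Op X χ k where
  obj := F.obj
  map := F.map
  map_id := F.map_id
  map_comp := F.map_comp

/-- A categorical equivalence is a morphism of operads in groupoids that is an equivalence of
categories in each arity. -/
def GrpdOperad.Hom.IsCategoricalEquivalence {P Q : GrpdOperad} (F : P.Hom Q) : Prop :=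
  ∀ (X : Type) [Finite X] (χ : X → Col) (k : Col), (F.functor X χ k).IsEquivalence

/-- Isomorphisms of operads in groupoids: pairs of mutually inverse morphisms. -/
structure GrpdOperad.Iso (P Q : GrpdOperad) where
  hom : P.Hom Q
  inv : Q.Hom P
  hom_inv {X : Type} [Finite X] {χ : X → Col} {k : Col} {p p' : P.Op X χ k} (f : p ⟶ p') :
    Arrow.mk (inv.map (hom.map f)) = Arrow.mk f
  inv_hom {X : Type} [Finite X] {χ : X → Col} {k : Col} {q q' : Q.Op X χ k} (f : q ⟶ q') :
    Arrow.mk (hom.map (inv.map f)) = Arrow.mk f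

/-! ## Images and pullbacks -/

/-- The image of a morphism of operads in sets. -/
def SetOperad.Hom.image {O P : SetOperad} (F : O.Hom P) : SetOperad where
  Op X _ χ k := {p : P.Op X χ k // ∃ u : O.Op X χ k, F.obj u = p}
  relabel e _ _ p := ⟨P.relabel e p.1, by
    obtain ⟨_, u, rfl⟩ := p; exact ⟨O.relabel e u, F.obj_relabel e u⟩⟩
  one k := ⟨P.one k, O.one k, F.obj_one k⟩
  comp p q := ⟨P.comp p.1 fun y => (q y).1, by
    obtain ⟨_, u, rfl⟩ := p
    choose v hv using fun y => (q y).2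
    exact ⟨O.comp u v, by rw [F.obj_comp]; simp only [hv]⟩⟩
  relabel_refl p := Subtype.ext (P.relabel_refl p.1)
  relabel_trans e e' _ _ p := Subtype.ext (P.relabel_trans e e' p.1)
  one_comp p := Subtype.ext (P.one_comp p.1)
  comp_one p := Subtype.ext (P.comp_one p.1)
  assoc p q r := Subtype.ext (P.assoc p.1 (fun y => (q y).1) fun y x => (r y x).1)
  comp_relabel e _ _ _ p q := Subtype.ext (P.comp_relabel e p.1 fun y => (q y).1)
  relabel_comp e _ _ _ _ _ p q := Subtype.ext (P.relabel_comp e p.1 fun y => (q y).1)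

/-- The inclusion of the image. -/
def SetOperad.Hom.imageIncl {O P : SetOperad} (F : O.Hom P) : F.image.Hom P where
  obj p := p.1
  obj_relabel _ _ _ _ := rfl
  obj_one _ := rfl
  obj_comp _ _ := rfl

section Cast

variable {C : Type*} [Category C]

/-- Change the endpoints of a morphism along equalities. -/
def castHom {a b a' b' : C} (h : a = a') (h' : b = b') (f : a' ⟶ b') : a ⟶ b :=
  eqToHom h ≫ f ≫ eqToHom h'.symm

theorem mk_castHom {a b a' b' : C} (h : a = a') (h' : b = b') (f : a' ⟶ b') :
    Arrow.mk (castHom h h' f) = Arrow.mk f := by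
  subst h h'; simp [castHom]

theorem castHom_id {a a' : C} (h : a = a') : castHom h h (𝟙 a') = 𝟙 a := by
  subst h; simp [castHom]

theorem castHom_comp {a b c a' b' c' : C} (h : a = a') (h' : b = b') (h'' : c = c')
    (f : a' ⟶ b') (g : b' ⟶ c') :
    castHom h h'' (f ≫ g) = castHom h h' f ≫ castHom h' h'' g := by
  subst h h' h''; simp [castHom]

theorem mk_eq_mk {a b a' b' : C} {f : a ⟶ b} {f' : a' ⟶ b'} :
    Arrow.mk f = Arrow.mk f' ↔ a = a' ∧ b = b' ∧ f ≍ f' := by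
  constructor
  · intro h
    have h1 := congrArg Comma.left h
    have h2 := congrArg Comma.right h
    simp only [Arrow.mk_left, Arrow.mk_right] at h1 h2
    subst h1 h2
    exact ⟨rfl, rfl, heq_of_eq ((Arrow.mk_inj _ _).1 h)⟩
  · rintro ⟨rfl, rfl, h⟩
    rw [eq_of_heq h]

end Cast

theorem GrpdOperad.relabelMap_congr (P : GrpdOperad) {X X' : Type} [Finite X] [Finite X']
    (e : X ≃ X') {χ : X' → Col} {k : Col} {p p' s s' : P.Op X (χ ∘ e) k} {f : p ⟶ p'} {g : s ⟶ s'}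
    (h : Arrow.mk f = Arrow.mk g) :
    Arrow.mk (P.relabelMap e f) = Arrow.mk (P.relabelMap e g) := by
  obtain ⟨rfl, rfl, h⟩ := mk_eq_mk.1 h
  rw [eq_of_heq h]

theorem GrpdOperad.compMap_congr (P : GrpdOperad) {Y : Type} [Finite Y] {X : Y → Type}
    [∀ y, Finite (X y)] {χ : Y → Col} {ξ : ∀ y, X y → Col} {k : Col} {p p' s s' : P.Op Y χ k}
    {q q' t t' : ∀ y, P.Op (X y) (ξ y) (χ y)} {f : p ⟶ p'} {f' : s ⟶ s'} {g : ∀ y, q y ⟶ q' y}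
    {g' : ∀ y, t y ⟶ t' y} (h : Arrow.mk f = Arrow.mk f')
    (h' : ∀ y, Arrow.mk (g y) = Arrow.mk (g' y)) :
    Arrow.mk (P.compMap f g) = Arrow.mk (P.compMap f' g') := by
  obtain ⟨rfl, rfl, h⟩ := mk_eq_mk.1 h
  obtain rfl : q = t := funext fun y => (mk_eq_mk.1 (h' y)).1
  obtain rfl : q' = t' := funext fun y => (mk_eq_mk.1 (h' y)).2.1
  obtain rfl : g = g' := funext fun y => eq_of_heq (mk_eq_mk.1 (h' y)).2.2
  rw [eq_of_heq h]

/-- The groupoid structure on operations pulled back along a map to the objects of `P`. -/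
@[reducible] def GrpdOperad.pullbackGrpd (P : GrpdOperad) {O : SetOperad}
    (F : O.Hom P.toSetOperad) (X : Type) [Finite X] (χ : X → Col) (k : Col) :
    Groupoid (O.Op X χ k) where
  Hom u v := F.obj u ⟶ F.obj v
  id u := 𝟙 (F.obj u)
  comp f g := f ≫ g
  inv f := Groupoid.inv f

theorem GrpdOperad.pullback_mk_eq (P : GrpdOperad) {O : SetOperad}
    (F : O.Hom P.toSetOperad) {X : Type} [Finite X] {χ : X → Col} {k : Col}
    {u v u' v' : O.Op X χ k} {f : F.obj u ⟶ F.obj v} {g : F.obj u' ⟶ F.obj v'}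
    (h : Arrow.mk f = Arrow.mk g) (hu : u = u') (hv : v = v') :
    @Arrow.mk (O.Op X χ k) (P.pullbackGrpd F X χ k).toCategory u v f =
      @Arrow.mk (O.Op X χ k) (P.pullbackGrpd F X χ k).toCategory u' v' g := by
  subst hu hv
  rw [eq_of_heq (mk_eq_mk.1 h).2.2]

/-- The pullback `F^* P` of an operad in groupoids `P` along a morphism of operads in sets
`F : O → ob P`: its objects are the operations of `O`, and `Hom(u, v) = Hom_P(F u, F v)`. When `F`
is an inclusion this is the full suboperad of `P` on these objects. -/
def GrpdOperad.pullback (P : GrpdOperad) {O : SetOperad} (F : O.Hom P.toSetOperad) :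
    GrpdOperad where
  toSetOperad := O
  grpd X _ χ k := P.pullbackGrpd F X χ k
  relabelMap {X X'} _ _ e χ k _ _ f :=
    castHom (C := P.Op X' χ k) (F.obj_relabel e _) (F.obj_relabel e _) (P.relabelMap e f)
  compMap {Y} _ {X} _ {χ ξ k} _ _ _ _ f g :=
    castHom (C := P.Op (Σ y, X y) (fun p => ξ p.1 p.2) k) (F.obj_comp _ _) (F.obj_comp _ _)
      (P.compMap f g)
  relabelMap_id {X X'} _ _ e χ k p := by
    refine (congrArg _ (P.relabelMap_id e (F.obj p))).trans ?_
    exact castHom_id (C := P.Op X' χ k) _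
  relabelMap_comp {X X'} _ _ e χ k _ _ _ f g := by
    refine (congrArg _ (P.relabelMap_comp e f g)).trans ?_
    exact castHom_comp (C := P.Op X' χ k) _ _ _ _ _
  compMap_id {Y} _ {X} _ {χ ξ k} p q := by
    refine (congrArg _ (P.compMap_id (F.obj p) fun y => F.obj (q y))).trans ?_
    exact castHom_id (C := P.Op (Σ y, X y) (fun p => ξ p.1 p.2) k) _
  compMap_comp {Y} _ {X} _ {χ ξ k} _ _ _ _ _ _ f f' g g' := by
    refine (congrArg _ (P.compMap_comp f f' g g')).trans ?_
    exact castHom_comp (C := P.Op (Σ y, X y) (fun p => ξ p.1 p.2) k) _ _ _ _ _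
  relabelMap_refl f := P.pullback_mk_eq F
    ((mk_castHom _ _ _).trans (P.relabelMap_refl f)) (O.relabel_refl _) (O.relabel_refl _)
  relabelMap_trans e e' _ _ _ _ f := P.pullback_mk_eq F
    ((mk_castHom _ _ _).trans <| (P.relabelMap_trans e e' f).trans <|
      (P.relabelMap_congr e' (mk_castHom _ _ _).symm).trans (mk_castHom _ _ _).symm)
    (O.relabel_trans e e' _) (O.relabel_trans e e' _)
  one_compMap {X} _ χ k _ _ f := P.pullback_mk_eq F
    ((mk_castHom _ _ _).trans <| (P.relabelMap_congr _ ((mk_castHom _ _ _).trans <|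
      P.compMap_congr (congrArg (fun a : P.Op Unit (fun _ => k) k => Arrow.mk (𝟙 a))
        (F.obj_one k)) fun _ => rfl)).trans <| P.one_compMap f)
    (O.one_comp _) (O.one_comp _)
  compMap_one {X} _ χ k _ _ f := P.pullback_mk_eq F
    ((mk_castHom _ _ _).trans <| (P.relabelMap_congr _ ((mk_castHom _ _ _).trans <|
      P.compMap_congr rfl fun x => congrArg
        (fun a : P.Op Unit (fun _ => χ x) (χ x) => Arrow.mk (𝟙 a)) (F.obj_one (χ x)))).trans <|
      P.compMap_one f)
    (O.comp_one _) (O.comp_one _)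
  assocMap f g h := P.pullback_mk_eq F
    ((mk_castHom _ _ _).trans <| (P.relabelMap_congr _ ((mk_castHom _ _ _).trans <|
      P.compMap_congr (mk_castHom _ _ _) fun _ => rfl)).trans <| (P.assocMap f g h).trans <|
      (P.compMap_congr rfl fun _ => (mk_castHom _ _ _).symm).trans (mk_castHom _ _ _).symm)
    (O.assoc _ _ _) (O.assoc _ _ _)
  compMap_relabel e _ _ _ _ _ _ _ f g := P.pullback_mk_eq F
    ((mk_castHom _ _ _).trans <| (P.compMap_congr rfl fun _ => mk_castHom _ _ _).trans <|
      (P.compMap_relabel e f g).trans <|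
      (P.relabelMap_congr _ (mk_castHom _ _ _).symm).trans (mk_castHom _ _ _).symm)
    (O.comp_relabel e _ _) (O.comp_relabel e _ _)
  relabelMap_compMap e _ _ _ _ _ _ _ _ _ f g := P.pullback_mk_eq F
    ((mk_castHom _ _ _).trans <|
      (P.compMap_congr (mk_castHom _ _ _) fun _ => rfl).trans <|
      (P.relabelMap_compMap e f g).trans <|
      (P.relabelMap_congr _ (mk_castHom _ _ _).symm).trans (mk_castHom _ _ _).symm)
    (O.relabel_comp e _ _) (O.relabel_comp e _ _)

/-- The canonical morphism `F^* P → P`: it is `F` on objects and the identity on morphisms. -/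
def GrpdOperad.pullbackProj (P : GrpdOperad) {O : SetOperad} (F : O.Hom P.toSetOperad) :
    (P.pullback F).Hom P where
  toHom := F
  map {_} _ _ _ p p' (f : F.obj p ⟶ F.obj p') := f
  map_id _ := rfl
  map_comp _ _ := rfl
  map_relabel e _ _ _ _ _ := mk_castHom (F.obj_relabel e _) (F.obj_relabel e _) _
  map_compMap _ _ := mk_castHom (F.obj_comp _ _) (F.obj_comp _ _) _

/-! ## Topological operads and their fundamental groupoids -/

/-- Two-coloured symmetric topological operads. -/
structure TopOperad extends SetOperad where
  /-- The topology on operations. -/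
  top (X : Type) [Finite X] (χ : X → Col) (k : Col) : TopologicalSpace (Op X χ k)
  continuous_relabel {X X' : Type} [Finite X] [Finite X'] (e : X ≃ X') {χ : X' → Col} {k : Col} :
    Continuous fun p : Op X (χ ∘ e) k => relabel e p
  continuous_comp {Y : Type} [Finite Y] {X : Y → Type} [∀ y, Finite (X y)] {χ : Y → Col}
    {ξ : ∀ y, X y → Col} {k : Col} :
    Continuous fun a : Op Y χ k × (∀ y, Op (X y) (ξ y) (χ y)) => comp a.1 a.2

attribute [instance] TopOperad.top

section Path

variable {A B : Type} [TopologicalSpace A] [TopologicalSpace B]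

/-- The morphism of the fundamental groupoid given by a path. -/
def pathHom {a b : A} (p : Path a b) : FundamentalGroupoid.mk a ⟶ FundamentalGroupoid.mk b :=
  Path.Homotopic.Quotient.mk p

theorem pathHom_surj {a b : FundamentalGroupoid A} (f : a ⟶ b) :
    ∃ p : Path a.as b.as, f = pathHom p := by
  obtain ⟨p, hp⟩ := Path.Homotopic.Quotient.mk_surjective f
  exact ⟨p, hp.symm⟩

theorem mk_pathHom_eq {a b a' b' : A} {p : Path a b} {q : Path a' b'} (h : ∀ t, p t = q t) :
    Arrow.mk (pathHom p) = Arrow.mk (pathHom q) := by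
  obtain rfl : a = a' := by simpa using h 0
  obtain rfl : b = b' := by simpa using h 1
  obtain rfl : p = q := Path.ext (funext h)
  rfl

/-- A path class, as an arrow of the fundamental groupoid. -/
noncomputable def mkQ {a b : A} (q : Path.Homotopic.Quotient a b) : Arrow (FundamentalGroupoid A) :=
  Arrow.mk (X := FundamentalGroupoid.mk a) (Y := FundamentalGroupoid.mk b) q

theorem mkQ_eq {a b a' b' : A} {p : Path a b} {q : Path a' b'} (h : ∀ t, p t = q t) :
    mkQ (Path.Homotopic.Quotient.mk p) = mkQ (Path.Homotopic.Quotient.mk q) :=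
  mk_pathHom_eq h

end Path

/-- The set operad of objects of the fundamental groupoid of `T`. -/
def TopOperad.piOb (T : TopOperad) : SetOperad where
  Op X _ χ k := FundamentalGroupoid (T.Op X χ k)
  relabel e _ _ p := ⟨T.relabel e p.as⟩
  one k := ⟨T.one k⟩
  comp p q := ⟨T.comp p.as fun y => (q y).as⟩
  relabel_refl p := FundamentalGroupoid.ext (T.relabel_refl p.as)
  relabel_trans e e' _ _ p := FundamentalGroupoid.ext (T.relabel_trans e e' p.as)
  one_comp p := FundamentalGroupoid.ext (T.one_comp p.as)
  comp_one p := FundamentalGroupoid.ext (T.comp_one p.as)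
  assoc p q r := FundamentalGroupoid.ext (T.assoc p.as (fun y => (q y).as) fun y x => (r y x).as)
  comp_relabel e _ _ _ p q := FundamentalGroupoid.ext (T.comp_relabel e p.as fun y => (q y).as)
  relabel_comp e _ _ _ _ _ p q :=
    FundamentalGroupoid.ext (T.relabel_comp e p.as fun y => (q y).as)

section

variable (T : TopOperad)

/-- Relabelling as a continuous map. -/
def TopOperad.relabelC {X X' : Type} [Finite X] [Finite X'] (e : X ≃ X') (χ : X' → Col) (k : Col) :
    C(T.Op X (χ ∘ e) k, T.Op X' χ k) :=
  ⟨fun p => T.relabel e p, T.continuous_relabel e⟩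

/-- Composition as a continuous map. -/
def TopOperad.compC {Y : Type} [Finite Y] {X : Y → Type} [∀ y, Finite (X y)] (χ : Y → Col)
    (ξ : ∀ y, X y → Col) (k : Col) :
    C(T.Op Y χ k × (∀ y, T.Op (X y) (ξ y) (χ y)), T.Op (Σ y, X y) (fun p => ξ p.1 p.2) k) :=
  ⟨fun a => T.comp a.1 a.2, T.continuous_comp⟩

/-- Relabelling of path classes. -/
def TopOperad.piRelabel {X X' : Type} [Finite X] [Finite X'] (e : X ≃ X') {χ : X' → Col} {k : Col}
    {p p' : T.piOb.Op X (χ ∘ e) k} (f : Path.Homotopic.Quotient p.as p'.as) :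
    Path.Homotopic.Quotient (T.piOb.relabel e p).as (T.piOb.relabel e p').as :=
  f.map (T.relabelC e χ k)

/-- Composition of path classes: the operadic composition of paths, applied pointwise. -/
noncomputable def TopOperad.piComp {Y : Type} [Finite Y] {X : Y → Type} [∀ y, Finite (X y)] {χ : Y → Col}
    {ξ : ∀ y, X y → Col} {k : Col} {p p' : T.piOb.Op Y χ k}
    {q q' : ∀ y, T.piOb.Op (X y) (ξ y) (χ y)}
    (f : Path.Homotopic.Quotient p.as p'.as)
    (g : ∀ y, Path.Homotopic.Quotient (q y).as (q' y).as) :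
    Path.Homotopic.Quotient (T.piOb.comp p q).as (T.piOb.comp p' q').as :=
  (Path.Homotopic.prod f (Path.Homotopic.pi g)).map (T.compC χ ξ k)

theorem TopOperad.piRelabel_mk {X X' : Type} [Finite X] [Finite X'] (e : X ≃ X') {χ : X' → Col}
    {k : Col} {p p' : T.piOb.Op X (χ ∘ e) k} (f : Path p.as p'.as) :
    T.piRelabel e (Path.Homotopic.Quotient.mk f) =
      Path.Homotopic.Quotient.mk (f.map (T.relabelC e χ k).continuous) := rfl

theorem TopOperad.piComp_mk {Y : Type} [Finite Y] {X : Y → Type} [∀ y, Finite (X y)] {χ : Y → Col}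
    {ξ : ∀ y, X y → Col} {k : Col} {p p' : T.piOb.Op Y χ k}
    {q q' : ∀ y, T.piOb.Op (X y) (ξ y) (χ y)} (f : Path p.as p'.as)
    (g : ∀ y, Path (q y).as (q' y).as) :
    T.piComp (Path.Homotopic.Quotient.mk f) (fun y => Path.Homotopic.Quotient.mk (g y)) =
      Path.Homotopic.Quotient.mk ((f.prod (Path.pi g)).map (T.compC χ ξ k).continuous) := by
  unfold piComp
  rw [Path.Homotopic.pi_lift]
  rfl

theorem TopOperad.piComp_trans {Y : Type} [Finite Y] {X : Y → Type} [∀ y, Finite (X y)]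
    {χ : Y → Col} {ξ : ∀ y, X y → Col} {k : Col} {p p' p'' : T.piOb.Op Y χ k}
    {q q' q'' : ∀ y, T.piOb.Op (X y) (ξ y) (χ y)}
    (f : Path.Homotopic.Quotient p.as p'.as) (f' : Path.Homotopic.Quotient p'.as p''.as)
    (g : ∀ y, Path.Homotopic.Quotient (q y).as (q' y).as)
    (g' : ∀ y, Path.Homotopic.Quotient (q' y).as (q'' y).as) :
    T.piComp (f.trans f') (fun y => (g y).trans (g' y)) =
      (T.piComp f g).trans (T.piComp f' g') := by
  unfold piComp
  rw [← Path.Homotopic.comp_pi_eq_pi_comp, ← Path.Homotopic.comp_prod_eq_prod_comp]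
  exact (FundamentalGroupoid.map (T.compC χ ξ k)).map_comp
    (X := ⟨(p.as, fun y => (q y).as)⟩) (Y := ⟨(p'.as, fun y => (q' y).as)⟩)
    (Z := ⟨(p''.as, fun y => (q'' y).as)⟩) _ _

theorem path_fam_surj {ι : Type} {A : ι → Type} [∀ i, TopologicalSpace (A i)]
    {a b : ∀ i, A i} (g : ∀ i, Path.Homotopic.Quotient (a i) (b i)) :
    ∃ p : ∀ i, Path (a i) (b i), g = fun i => Path.Homotopic.Quotient.mk (p i) := by
  choose p hp using fun i => Path.Homotopic.Quotient.mk_surjective (g i)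
  exact ⟨p, funext fun i => (hp i).symm⟩

end

/-- The fundamental groupoid of a topological operad, an operad in groupoids. -/
noncomputable def TopOperad.pi (T : TopOperad) : GrpdOperad where
  toSetOperad := T.piOb
  grpd X _ χ k := inferInstanceAs (Groupoid (FundamentalGroupoid (T.Op X χ k)))
  relabelMap e _ _ _ _ f := T.piRelabel e f
  compMap f g := T.piComp f g
  relabelMap_id e _ _ p := rfl
  relabelMap_comp e χ k _ _ _ f g := (FundamentalGroupoid.map (T.relabelC e χ k)).map_comp f g
  compMap_id {_} _ {_} _ {χ ξ k} p q := T.piComp_mk (Path.refl p.as) fun y => Path.refl (q y).as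
  compMap_comp f f' g g' := T.piComp_trans f f' g g'
  relabelMap_refl f := by
    obtain ⟨f, rfl⟩ := Path.Homotopic.Quotient.mk_surjective f
    exact mk_pathHom_eq fun t => T.relabel_refl (f t)
  relabelMap_trans e e' _ _ _ _ f := by
    obtain ⟨f, rfl⟩ := Path.Homotopic.Quotient.mk_surjective f
    exact mk_pathHom_eq fun t => T.relabel_trans e e' (f t)
  one_compMap {X} _ χ k p p' f := by
    obtain ⟨f, rfl⟩ := Path.Homotopic.Quotient.mk_surjective f
    refine Eq.trans (congrArg (fun a => mkQ (T.piRelabel _ a))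
      (T.piComp_mk (p := T.piOb.one k) (p' := T.piOb.one k) (q := fun _ : Unit => p)
        (q' := fun _ => p') (Path.refl (T.one k)) fun _ => f)) ?_
    exact mkQ_eq fun t => T.one_comp (f t)
  compMap_one {X} _ χ k p p' f := by
    obtain ⟨f, rfl⟩ := Path.Homotopic.Quotient.mk_surjective f
    refine Eq.trans (congrArg (fun a => mkQ (T.piRelabel _ a))
      (T.piComp_mk (q := fun x : X => T.piOb.one (χ x))
        (q' := fun x : X => T.piOb.one (χ x)) f fun x => Path.refl (T.one (χ x)))) ?_
    exact mkQ_eq fun t => T.comp_one (f t)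
  assocMap {Y} _ {X} _ {Z} _ χ ξ ζ k p p' q q' r r' f g h := by
    obtain ⟨f, rfl⟩ := Path.Homotopic.Quotient.mk_surjective f
    obtain ⟨g, rfl⟩ := path_fam_surj g
    choose h' hh using fun y => path_fam_surj (h y)
    obtain rfl : h = fun y x => Path.Homotopic.Quotient.mk (h' y x) := funext hh
    have h1 := T.piComp_mk f g
    have h3 := fun y => T.piComp_mk (g y) (h' y)
    have h2 := (congrArg (fun a => T.piComp (p := T.piOb.comp p q) (p' := T.piOb.comp p' q')
      (q := fun w : (Σ y, X y) => r w.1 w.2) (q' := fun w : (Σ y, X y) => r' w.1 w.2) a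
      fun w => Path.Homotopic.Quotient.mk (h' w.1 w.2)) h1).trans (T.piComp_mk _ _)
    refine Eq.trans (congrArg (fun a => mkQ (T.piRelabel
      (χ := fun v : (Σ y, Σ x, Z y x) => ζ v.1 v.2.1 v.2.2) (Equiv.sigmaAssoc Z) a)) h2) ?_
    refine Eq.trans ?_ (congrArg (fun a => mkQ (T.piComp _ a)) (funext h3)).symm
    refine Eq.trans ?_ (congrArg mkQ (T.piComp_mk (q := fun y => T.piOb.comp (q y) (r y))
      (q' := fun y => T.piOb.comp (q' y) (r' y)) f
      fun y => ((g y).prod (Path.pi (h' y))).map (T.compC (ξ y) (ζ y) (χ y)).continuous)).symm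
    exact mkQ_eq fun t => T.assoc (f t) (fun y => g y t) fun y x => h' y x t
  compMap_relabel e _ _ _ _ _ _ _ f g := by
    obtain ⟨f, rfl⟩ := Path.Homotopic.Quotient.mk_surjective f
    obtain ⟨g, rfl⟩ := path_fam_surj g
    refine Eq.trans (congrArg mkQ (T.piComp_mk _ _)) ?_
    refine Eq.trans ?_ (congrArg (fun a => mkQ (T.piRelabel _ a)) (T.piComp_mk f g)).symm
    exact mkQ_eq fun t => T.comp_relabel e (f t) fun y => g y t
  relabelMap_compMap e _ _ _ _ _ _ _ _ _ f g := by
    obtain ⟨f, rfl⟩ := Path.Homotopic.Quotient.mk_surjective f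
    obtain ⟨g, rfl⟩ := path_fam_surj g
    refine Eq.trans (congrArg mkQ (T.piComp_mk _ _)) ?_
    refine Eq.trans ?_ (congrArg (fun a => mkQ (T.piRelabel _ a)) (T.piComp_mk _ _)).symm
    exact mkQ_eq fun t => T.relabel_comp e (f t) fun y => g y t

/-! ## The Swiss-Cheese operad -/

/-- The affine map `z ↦ a + r z`, encoded as `(a, r)`; for `r > 0` it is the embedding of the unit
disk (or unit half disk) with centre `a` and radius `r`. -/
abbrev Disk : Type := ℂ × ℝ

/-- Composition of affine maps. -/
def Disk.mul (d e : Disk) : Disk := (d.1 + d.2 * e.1, d.2 * e.2)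

theorem Disk.mul_assoc (d e f : Disk) : (d.mul e).mul f = d.mul (e.mul f) := by
  simp only [Disk.mul, Prod.mk.injEq]
  push_cast
  constructor <;> ring

theorem Disk.one_mul (d : Disk) : Disk.mul (0, 1) d = d := by
  simp [Disk.mul]

theorem Disk.mul_one (d : Disk) : d.mul (0, 1) = d := by
  simp [Disk.mul]

/-- The configurations of the Swiss-Cheese operad: families of little disks with disjoint interiors,
indexed by a non-empty set `X`. If the output is closed, all inputs are closed and these are full
disks in the unit disk. If the output is open they lie in the unit upper half disk: open inputs
are upper half disks centred on the real axis, closed inputs are full disks in the upper half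
plane. (As full disks do not cross the real axis, two such pieces have disjoint interiors if and
only if the sum of the radii is at most the distance of the centres.) -/
structure IsSC {X : Type} (χ : X → Col) (k : Col) (d : X → Disk) : Prop where
  nonempty : Nonempty X
  pos (x : X) : 0 < (d x).2
  norm_le (x : X) : ‖(d x).1‖ + (d x).2 ≤ 1
  disj (x y : X) : x ≠ y → (d x).2 + (d y).2 ≤ ‖(d x).1 - (d y).1‖
  closed (h : k = Col.c) (x : X) : χ x = Col.c
  half (h : k = Col.o) (x : X) : χ x = Col.o → (d x).1.im = 0
  full (h : k = Col.o) (x : X) : χ x = Col.c → (d x).2 ≤ (d x).1.im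

/-- The space `SC(X, χ; k)`, topologized by centres and radii. -/
abbrev SCSpace (X : Type) (χ : X → Col) (k : Col) : Type := {d : X → Disk // IsSC χ k d}

theorem isSC_relabel {X X' : Type} (e : X ≃ X') {χ : X' → Col} {k : Col} {d : X → Disk}
    (h : IsSC (χ ∘ e) k d) : IsSC χ k (d ∘ e.symm) where
  nonempty := h.nonempty.map e
  pos x := h.pos _
  norm_le x := h.norm_le _
  disj x y hxy := h.disj _ _ fun h' => hxy (e.symm.injective h')
  closed hk x := by simpa using h.closed hk (e.symm x)
  half hk x hx := h.half hk (e.symm x) (by simpa using hx)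
  full hk x hx := h.full hk (e.symm x) (by simpa using hx)

theorem isSC_one (k : Col) : IsSC (fun _ : Unit => k) k fun _ => ((0, 1) : Disk) where
  nonempty := inferInstance
  pos _ := by simp
  norm_le _ := by simp
  disj x y hxy := (hxy rfl).elim
  closed hk _ := hk
  half _ _ _ := by simp
  full hk _ hx := by subst hk; cases hx

theorem isSC_comp {Y : Type} {X : Y → Type} {χ : Y → Col} {ξ : ∀ y, X y → Col} {k : Col}
    {d : Y → Disk} {e : ∀ y, X y → Disk} (hd : IsSC χ k d) (he : ∀ y, IsSC (ξ y) (χ y) (e y)) :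
    IsSC (fun p : (Σ y, X y) => ξ p.1 p.2) k fun p => (d p.1).mul (e p.1 p.2) where
  nonempty := by
    obtain ⟨y⟩ := hd.nonempty
    obtain ⟨x⟩ := (he y).nonempty
    exact ⟨⟨y, x⟩⟩
  pos p := mul_pos (hd.pos _) ((he _).pos _)
  norm_le := by
    rintro ⟨y, x⟩
    have h1 := hd.norm_le y
    have h2 := (he y).norm_le x
    have h3 := hd.pos y
    have h4 := norm_add_le (d y).1 ((d y).2 * (e y x).1)
    rw [norm_mul, Complex.norm_real, Real.norm_of_nonneg h3.le] at h4
    simp only [Disk.mul]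
    nlinarith
  disj := by
    rintro ⟨y, x⟩ ⟨y', x'⟩ hne
    simp only [Disk.mul]
    by_cases hy : y = y'
    · subst hy
      have hx : x ≠ x' := fun h => hne (by rw [h])
      have h3 := hd.pos y
      have h1 := (he y).disj x x' hx
      have : (d y).1 + (d y).2 * (e y x).1 - ((d y).1 + (d y).2 * (e y x').1)
          = (d y).2 * ((e y x).1 - (e y x').1) := by ring
      rw [this, norm_mul, Complex.norm_real, Real.norm_of_nonneg h3.le]
      nlinarith
    · have h1 := hd.disj y y' hy
      have h2 := hd.pos y
      have h3 := hd.pos y'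
      have h4 := (he y).norm_le x
      have h5 := (he y').norm_le x'
      have h6 : ‖(d y).1 - (d y').1‖ ≤
          ‖(d y).1 + (d y).2 * (e y x).1 - ((d y').1 + (d y').2 * (e y' x').1)‖
          + ‖((d y).2 : ℂ) * (e y x).1‖ + ‖((d y').2 : ℂ) * (e y' x').1‖ := by
        have := norm_add₃_le (a := (d y).1 + (d y).2 * (e y x).1 -
          ((d y').1 + (d y').2 * (e y' x').1)) (b := -(((d y).2 : ℂ) * (e y x).1))
          (c := ((d y').2 : ℂ) * (e y' x').1)
        rw [norm_neg] at this
        refine le_trans (le_of_eq ?_) this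
        congr 1
        ring
      rw [norm_mul, Complex.norm_real, Real.norm_of_nonneg h2.le, norm_mul, Complex.norm_real,
        Real.norm_of_nonneg h3.le] at h6
      nlinarith
  closed hk p := (he p.1).closed (hd.closed hk p.1) p.2
  half := by
    rintro hk ⟨y, x⟩ hx
    have hy : χ y = Col.o := by
      cases h : χ y with
      | o => rfl
      | c => have := (he y).closed h x; rw [this] at hx; cases hx
    have h1 := hd.half hk y hy
    have h2 := (he y).half hy x hx
    simp [Disk.mul, h1, h2]
  full := by
    rintro hk ⟨y, x⟩ hx
    have h0 := hd.pos y
    cases hy : χ y with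
    | o =>
      have h1 := hd.half hk y hy
      have h2 := (he y).full hy x hx
      simp only [Disk.mul, Complex.add_im, Complex.mul_im, Complex.ofReal_re, Complex.ofReal_im, h1]
      nlinarith
    | c =>
      have h1 := hd.full hk y hy
      have h2 := (he y).norm_le x
      have h3 := Complex.abs_im_le_norm (e y x).1
      have h4 := neg_abs_le (e y x).1.im
      simp only [Disk.mul, Complex.add_im, Complex.mul_im, Complex.ofReal_re, Complex.ofReal_im]
      nlinarith

/-- The Swiss-Cheese operad: composition is composition of embeddings. -/
def SC : TopOperad where
  Op X _ χ k := SCSpace X χ k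
  relabel e _ _ p := ⟨p.1 ∘ e.symm, isSC_relabel e p.2⟩
  one k := ⟨fun _ => (0, 1), isSC_one k⟩
  comp p q := ⟨fun w => (p.1 w.1).mul ((q w.1).1 w.2), isSC_comp p.2 fun y => (q y).2⟩
  relabel_refl _ := rfl
  relabel_trans _ _ _ _ _ := rfl
  one_comp p := Subtype.ext <| funext fun x => Disk.one_mul _
  comp_one p := Subtype.ext <| funext fun x => Disk.mul_one _
  assoc p q r := Subtype.ext <| funext fun x => Disk.mul_assoc _ _ _
  comp_relabel e _ _ _ p q := rfl
  relabel_comp e X _ χ ξ _ p q := Subtype.ext <| funext fun x => by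
    obtain ⟨x, rfl⟩ := (Equiv.sigmaCongrLeft e).surjective x
    refine Eq.trans ?_ (congrArg (fun v : (Σ y, X (e y)) => (p.1 v.1).mul ((q (e v.1)).1 v.2))
      ((Equiv.sigmaCongrLeft e).symm_apply_apply x)).symm
    change (p.1 (e.symm (e x.1))).mul ((q (e x.1)).1 x.2) = _
    rw [Equiv.symm_apply_apply]
  top X _ χ k := inferInstanceAs (TopologicalSpace (SCSpace X χ k))
  continuous_relabel e _ _ := by
    refine Continuous.subtype_mk ?_ _
    refine continuous_pi fun x => ?_
    exact (continuous_apply (e.symm x)).comp continuous_subtype_val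
  continuous_comp {Y} _ {X} _ {χ ξ k} := by
    refine Continuous.subtype_mk ?_ _
    refine continuous_pi fun x => ?_
    have h1 : Continuous fun a : SCSpace Y χ k × (∀ y, SCSpace (X y) (ξ y) (χ y)) => a.1.1 x.1 :=
      (continuous_apply x.1).comp (continuous_subtype_val.comp continuous_fst)
    have h2 : Continuous fun a : SCSpace Y χ k × (∀ y, SCSpace (X y) (ξ y) (χ y)) => (a.2 x.1).1 x.2 :=
      (continuous_apply x.2).comp
        (continuous_subtype_val.comp ((continuous_apply x.1).comp continuous_snd))
    exact (h1.fst.add ((Complex.continuous_ofReal.comp h1.snd).mul h2.fst)).prodMk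
      (h1.snd.mul h2.snd)

/-! ## The free operad on `μ_c`, `f`, `μ_o` -/

/-- Formal iterated products of variables `x : X` of colours `χ x`, with the operations
`μ_c : c, c → c`, `f : c → o` and `μ_o : o, o → o`. -/
inductive Tree {X : Type} (χ : X → Col) : Col → Type
  | leaf (x : X) : Tree χ (χ x)
  | mulc (s t : Tree χ Col.c) : Tree χ Col.c
  | f (s : Tree χ Col.c) : Tree χ Col.o
  | mulo (s t : Tree χ Col.o) : Tree χ Col.o

namespace Tree

variable {X Y Z : Type} {χ : X → Col} {ξ : Y → Col} {ζ : Z → Col} {k : Col}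

/-- Substitution of trees for the variables. -/
def bind {k : Col} : Tree χ k → (∀ x, Tree ξ (χ x)) → Tree ξ k
  | leaf x, u => u x
  | mulc s t, u => mulc (s.bind u) (t.bind u)
  | f s, u => f (s.bind u)
  | mulo s t, u => mulo (s.bind u) (t.bind u)

/-- The list of variables, from left to right. -/
def leaves {k : Col} : Tree χ k → List X
  | leaf x => [x]
  | mulc s t => s.leaves ++ t.leaves
  | f s => s.leaves
  | mulo s t => s.leaves ++ t.leaves

theorem bind_leaf (t : Tree χ k) : t.bind leaf = t := by
  induction t with
  | leaf x => rfl
  | mulc s t hs ht => simp [bind, hs, ht]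
  | f s hs => simp [bind, hs]
  | mulo s t hs ht => simp [bind, hs, ht]

theorem bind_bind (t : Tree χ k) (u : ∀ x, Tree ξ (χ x)) (v : ∀ y, Tree ζ (ξ y)) :
    (t.bind u).bind v = t.bind fun x => (u x).bind v := by
  induction t with
  | leaf x => rfl
  | mulc s t hs ht => simp [bind, hs, ht]
  | f s hs => simp [bind, hs]
  | mulo s t hs ht => simp [bind, hs, ht]

theorem leaves_bind (t : Tree χ k) (u : ∀ x, Tree ξ (χ x)) :
    (t.bind u).leaves = t.leaves.flatMap fun x => (u x).leaves := by
  induction t with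
  | leaf x => simp [bind, leaves]
  | mulc s t hs ht => simp [bind, leaves, hs, ht]
  | f s hs => simp [bind, leaves, hs]
  | mulo s t hs ht => simp [bind, leaves, hs, ht]

theorem leaves_ne_nil (t : Tree χ k) : t.leaves ≠ [] := by
  induction t with
  | leaf x => simp [leaves]
  | mulc s t hs ht => simp [leaves, hs]
  | f s hs => simpa [leaves] using hs
  | mulo s t hs ht => simp [leaves, hs]

theorem closed_of_mem (t : Tree χ k) (hk : k = Col.c) : ∀ x ∈ t.leaves, χ x = Col.c := by
  induction t with
  | leaf x => simpa [leaves] using hk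
  | mulc s t hs ht =>
    intro x hx
    rcases List.mem_append.1 hx with h | h
    · exact hs rfl x h
    · exact ht rfl x h
  | f s hs => cases hk
  | mulo s t hs ht => cases hk

end Tree

/-- The total orders on a set `X`, as lists without repetition of all elements. -/
def IsOrder {X : Type} (l : List X) : Prop := l.Nodup ∧ ∀ x, x ∈ l

theorem isOrder_map {X X' : Type} (e : X ≃ X') {l : List X} (h : IsOrder l) :
    IsOrder (l.map e) :=
  ⟨h.1.map e.injective, fun x => List.mem_map.2 ⟨e.symm x, h.2 _, by simp⟩⟩

/-- Lexicographic substitution of lists. -/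
def lexList {Y : Type} {X : Y → Type} (l : List Y) (m : ∀ y, List (X y)) : List (Σ y, X y) :=
  l.flatMap fun y => (m y).map (Sigma.mk y)

theorem isOrder_lex {Y : Type} {X : Y → Type} {l : List Y} {m : ∀ y, List (X y)}
    (hl : IsOrder l) (hm : ∀ y, IsOrder (m y)) : IsOrder (lexList l m) := by
  refine ⟨?_, ?_⟩
  · refine List.nodup_flatMap.2 ⟨fun y _ => (hm y).1.map sigma_mk_injective, ?_⟩
    refine hl.1.imp fun {a b} hab => ?_
    intro w h1 h2
    obtain ⟨x, _, rfl⟩ := List.mem_map.1 h1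
    obtain ⟨x', _, h⟩ := List.mem_map.1 h2
    exact hab (congrArg Sigma.fst h).symm
  · rintro ⟨y, x⟩
    exact List.mem_flatMap.2 ⟨y, hl.2 y, List.mem_map.2 ⟨x, (hm y).2 x, rfl⟩⟩

namespace Tree

/-- Relabelling of the variables. -/
def rel {X X' : Type} (e : X → X') {χ : X' → Col} {k : Col} (t : Tree (χ ∘ e) k) : Tree χ k :=
  t.bind fun x => leaf (χ := χ) (e x)

/-- Substitution of trees with disjoint sets of variables. -/
def sub {Y : Type} {X : Y → Type} {χ : Y → Col} {ξ : ∀ y, X y → Col} {k : Col} (t : Tree χ k)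
    (u : ∀ y, Tree (ξ y) (χ y)) : Tree (fun w : (Σ y, X y) => ξ w.1 w.2) k :=
  t.bind fun y => rel (χ := fun w : (Σ y, X y) => ξ w.1 w.2) (Sigma.mk y) (u y)

theorem leaves_rel {X X' : Type} (e : X → X') {χ : X' → Col} {k : Col} (t : Tree (χ ∘ e) k) :
    (t.rel e).leaves = t.leaves.map e := by
  refine (leaves_bind _ _).trans ?_
  exact List.flatMap_pure_eq_map e t.leaves

theorem leaves_sub {Y : Type} {X : Y → Type} {χ : Y → Col} {ξ : ∀ y, X y → Col} {k : Col}
    (t : Tree χ k) (u : ∀ y, Tree (ξ y) (χ y)) :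
    (t.sub u).leaves = lexList t.leaves fun y => (u y).leaves := by
  refine (leaves_bind _ _).trans ?_
  unfold lexList
  congr 1
  funext y
  exact leaves_rel _ _

theorem rel_rel {X X' X'' : Type} (e : X → X') (e' : X' → X'') {χ : X'' → Col} {k : Col}
    (t : Tree ((χ ∘ e') ∘ e) k) : rel (χ := χ) (fun x => e' (e x)) t = rel e' (rel e t) := by
  unfold rel
  exact (bind_bind t (fun x => leaf (χ := χ ∘ e') (e x)) fun x => leaf (χ := χ) (e' x)).symm

theorem rel_id {X : Type} {χ : X → Col} {k : Col} (t : Tree χ k) :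
    rel (χ := χ) (fun x => x) t = t := t.bind_leaf

theorem rel_sub {Y : Type} {X : Y → Type} {W : Type} {χ : Y → Col} {ξ : W → Col} {k : Col}
    (e : (Σ y, X y) → W) (t : Tree χ k) (u : ∀ y, Tree (fun x => ξ (e ⟨y, x⟩)) (χ y)) :
    rel (χ := ξ) e (sub (ξ := fun y x => ξ (e ⟨y, x⟩)) t u) =
      t.bind fun y => rel (χ := ξ) (fun x => e ⟨y, x⟩) (u y) := by
  refine (bind_bind _ _ _).trans ?_
  congr 1
  funext y
  exact (rel_rel (Sigma.mk y) e (u y)).symm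

end Tree

/-- The free operad on `μ_c`, `f` and `μ_o`: an operation with inputs `X` is a tree in which each
variable `x : X` occurs exactly once. -/
def MagMag : SetOperad where
  Op X _ χ k := {t : Tree χ k // IsOrder t.leaves}
  relabel e χ _ p := ⟨p.1.rel e, by rw [Tree.leaves_rel]; exact isOrder_map e p.2⟩
  one k := ⟨Tree.leaf (χ := fun _ : Unit => k) (), by simp [IsOrder, Tree.leaves]⟩
  comp p q := ⟨p.1.sub fun y => (q y).1, by
    rw [Tree.leaves_sub]; exact isOrder_lex p.2 fun y => (q y).2⟩
  relabel_refl p := Subtype.ext p.1.rel_id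
  relabel_trans e e' _ _ p := Subtype.ext (p.1.rel_rel e e')
  one_comp {X} _ χ k p := Subtype.ext <| by
    refine (Tree.rel_sub (Y := Unit) (X := fun _ => X) (ξ := χ)
      (Equiv.uniqueSigma fun _ : Unit => X) (Tree.leaf (χ := fun _ : Unit => k) ())
      (fun _ => p.1)).trans ?_
    exact p.1.rel_id
  comp_one p := Subtype.ext <| by
    refine (Tree.rel_sub (Equiv.sigmaUnique _ fun _ => Unit) _ _).trans ?_
    exact p.1.rel_id
  assoc {Y} _ {X} _ {Z} _ χ ξ ζ k p q r := Subtype.ext <| by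
    refine (Tree.rel_sub (Equiv.sigmaAssoc Z) (ξ := fun v : (Σ y, Σ x, Z y x) => ζ v.1 v.2.1 v.2.2)
      (p.1.sub fun y => (q y).1) _).trans ?_
    refine (Tree.bind_bind _ _ _).trans ?_
    change _ = Tree.sub p.1 fun y => (Tree.sub (q y).1 fun x => (r y x).1)
    unfold Tree.sub
    congr 1
    funext y
    refine (Tree.bind_bind _ _ _).trans (Eq.trans ?_ (Tree.bind_bind _ _ _).symm)
    congr 1
    funext x
    exact Tree.rel_rel (X' := (Σ x, Z y x))
      (χ := fun v : (Σ y, Σ x, Z y x) => ζ v.1 v.2.1 v.2.2) (Sigma.mk (β := Z y) x)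
      (Sigma.mk (β := fun y => Σ x, Z y x) y) (r y x).1
  comp_relabel {Y} _ {X X'} _ _ e χ ξ k p q := Subtype.ext <| by
    refine Eq.trans ?_ (Tree.rel_sub (Equiv.sigmaCongrRight e)
      (ξ := fun v : (Σ y, X' y) => ξ v.1 v.2) _ _).symm
    change Tree.bind _ _ = _
    congr 1
    funext y
    exact (Tree.rel_rel (χ := fun v : (Σ y, X' y) => ξ v.1 v.2) (e y) (Sigma.mk y) (q y).1).symm
  relabel_comp {Y Y'} _ _ e {X} _ {χ ξ k} p q := Subtype.ext <| by
    refine Eq.trans (Tree.bind_bind _ _ _) (Tree.rel_sub (Equiv.sigmaCongrLeft e)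
      (ξ := fun v : (Σ y, X y) => ξ v.1 v.2) _ _).symm

/-! ### The morphism to the Swiss-Cheese operad -/

open Classical in
/-- The disk of the variable `x` in the configuration of a tree: `μ_c` (resp. `μ_o`) places two
full disks (resp. half disks) of radius `1/2` with centres `-1/2` and `1/2`, and `f` places a full
disk of radius `1/2` with centre `i/2`. -/
noncomputable def Tree.disk {X : Type} {χ : X → Col} {k : Col} : Tree χ k → X → Disk
  | .leaf _, _ => (0, 1)
  | .mulc s t, x =>
    if x ∈ s.leaves then Disk.mul (-1 / 2, 1 / 2) (s.disk x) else Disk.mul (1 / 2, 1 / 2) (t.disk x)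
  | .f s, x => Disk.mul (Complex.I / 2, 1 / 2) (s.disk x)
  | .mulo s t, x =>
    if x ∈ s.leaves then Disk.mul (-1 / 2, 1 / 2) (s.disk x) else Disk.mul (1 / 2, 1 / 2) (t.disk x)

/-- Horizontal separation: the disk `d` lies on the left of the disk `e`. -/
def LeftOf (d e : Disk) : Prop := d.1.re + d.2 ≤ e.1.re - e.2

theorem LeftOf.mul {a d e : Disk} (ha : 0 < a.2) (h : LeftOf d e) :
    LeftOf (a.mul d) (a.mul e) := by
  simp only [LeftOf, Disk.mul, Complex.add_re, Complex.mul_re, Complex.ofReal_re,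
    Complex.ofReal_im] at *
  nlinarith

theorem LeftOf.mul_mul {a b d e : Disk} (h : LeftOf a b) (ha : 0 < a.2) (hb : 0 < b.2)
    (hd : ‖d.1‖ + d.2 ≤ 1) (he : ‖e.1‖ + e.2 ≤ 1) : LeftOf (a.mul d) (b.mul e) := by
  have h1 := (abs_le.1 (Complex.abs_re_le_norm d.1)).2
  have h2 := (abs_le.1 (Complex.abs_re_le_norm e.1)).1
  simp only [LeftOf, Disk.mul, Complex.add_re, Complex.mul_re, Complex.ofReal_re,
    Complex.ofReal_im] at *
  nlinarith

theorem LeftOf.disj {d e : Disk} (h : LeftOf d e) : d.2 + e.2 ≤ ‖d.1 - e.1‖ := by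
  have h1 := (abs_le.1 (Complex.abs_re_le_norm (d.1 - e.1))).1
  simp only [LeftOf, Complex.sub_re] at *
  linarith

theorem disj_of_pairwise {X : Type} {l : List X} (hl : IsOrder l) {d : X → Disk}
    (h : l.Pairwise fun x y => LeftOf (d x) (d y)) (x y : X) (hxy : x ≠ y) :
    (d x).2 + (d y).2 ≤ ‖(d x).1 - (d y).1‖ := by
  have : Std.Symm fun x y => (d x).2 + (d y).2 ≤ ‖(d x).1 - (d y).1‖ :=
    ⟨fun x y h => by rwa [add_comm, norm_sub_rev]⟩
  exact (h.imp fun h => h.disj : l.Pairwise fun x y => (d x).2 + (d y).2 ≤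
    ‖(d x).1 - (d y).1‖).forall (hl.2 x) (hl.2 y) hxy

namespace Tree

section

variable {X : Type} {χ : X → Col} {x : X}

theorem mulc_disk_pos {s t : Tree χ Col.c} (h : x ∈ s.leaves) :
    (mulc s t).disk x = Disk.mul (-1 / 2, 1 / 2) (s.disk x) := if_pos h

theorem mulc_disk_neg {s t : Tree χ Col.c} (h : x ∉ s.leaves) :
    (mulc s t).disk x = Disk.mul (1 / 2, 1 / 2) (t.disk x) := if_neg h

theorem mulo_disk_pos {s t : Tree χ Col.o} (h : x ∈ s.leaves) :
    (mulo s t).disk x = Disk.mul (-1 / 2, 1 / 2) (s.disk x) := if_pos h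

theorem mulo_disk_neg {s t : Tree χ Col.o} (h : x ∉ s.leaves) :
    (mulo s t).disk x = Disk.mul (1 / 2, 1 / 2) (t.disk x) := if_neg h

end

theorem disk_spec {X : Type} {χ : X → Col} {k : Col} (t : Tree χ k) (x : X) (hx : x ∈ t.leaves) :
    0 < (t.disk x).2 ∧ ‖(t.disk x).1‖ + (t.disk x).2 ≤ 1 ∧
      (k = Col.o → (χ x = Col.o → (t.disk x).1.im = 0) ∧
        (χ x = Col.c → (t.disk x).2 ≤ (t.disk x).1.im)) := by
  have key (a d : Disk) (ha : 0 < a.2) (ha' : ‖a.1‖ + a.2 ≤ 1) (hd : 0 < d.2)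
      (hd' : ‖d.1‖ + d.2 ≤ 1) : 0 < (a.mul d).2 ∧ ‖(a.mul d).1‖ + (a.mul d).2 ≤ 1 := by
    refine ⟨mul_pos ha hd, ?_⟩
    have h4 := norm_add_le a.1 (a.2 * d.1)
    rw [norm_mul, Complex.norm_real, Real.norm_of_nonneg ha.le] at h4
    simp only [Disk.mul]
    nlinarith
  have hL : ‖(-1 / 2 : ℂ)‖ + (1 / 2 : ℝ) ≤ 1 := by norm_num
  have hR : ‖(1 / 2 : ℂ)‖ + (1 / 2 : ℝ) ≤ 1 := by norm_num
  have hU : ‖(Complex.I / 2 : ℂ)‖ + (1 / 2 : ℝ) ≤ 1 := by norm_num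
  have h2 : (0 : ℝ) < 1 / 2 := by norm_num
  have him (a d : Disk) (ha : a.1.im = 0) : (a.mul d).1.im = a.2 * d.1.im := by
    simp [Disk.mul, ha]
  induction t with
  | leaf y =>
    obtain rfl : x = y := by simpa [leaves] using hx
    refine ⟨by simp [disk], by simp [disk], fun h => ⟨fun _ => by simp [disk], fun h' => ?_⟩⟩
    rw [h] at h'
    cases h'
  | mulc s t hs ht =>
    by_cases h : x ∈ s.leaves
    · obtain ⟨h3, h4, -⟩ := hs h
      obtain ⟨h5, h6⟩ := key (-1 / 2, 1 / 2) _ h2 hL h3 h4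
      simp only [disk, if_pos h]
      exact ⟨h5, h6, fun h => by cases h⟩
    · have hx' : x ∈ t.leaves := (List.mem_append.1 hx).resolve_left h
      obtain ⟨h3, h4, -⟩ := ht hx'
      obtain ⟨h5, h6⟩ := key (1 / 2, 1 / 2) _ h2 hR h3 h4
      simp only [disk, if_neg h]
      exact ⟨h5, h6, fun h => by cases h⟩
  | f s hs =>
    obtain ⟨h3, h4, -⟩ := hs hx
    obtain ⟨h5, h6⟩ := key (Complex.I / 2, 1 / 2) _ h2 hU h3 h4
    refine ⟨h5, h6, fun _ => ⟨fun h => ?_, fun _ => ?_⟩⟩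
    · rw [s.closed_of_mem rfl x hx] at h
      cases h
    · have h7 := (abs_le.1 (Complex.abs_im_le_norm (s.disk x).1)).1
      simp only [disk, Disk.mul, Complex.add_im, Complex.mul_im, Complex.ofReal_re,
        Complex.ofReal_im]
      norm_num
      linarith
  | mulo s t hs ht =>
    by_cases h : x ∈ s.leaves
    · obtain ⟨h3, h4, h7⟩ := hs h
      obtain ⟨h5, h6⟩ := key (-1 / 2, 1 / 2) _ h2 hL h3 h4
      simp only [disk, if_pos h]
      refine ⟨h5, h6, fun _ => ?_⟩
      rw [him _ _ (by norm_num)]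
      exact ⟨fun h => by rw [(h7 rfl).1 h]; simp,
        fun h => mul_le_mul_of_nonneg_left ((h7 rfl).2 h) h2.le⟩
    · have hx' : x ∈ t.leaves := (List.mem_append.1 hx).resolve_left h
      obtain ⟨h3, h4, h7⟩ := ht hx'
      obtain ⟨h5, h6⟩ := key (1 / 2, 1 / 2) _ h2 hR h3 h4
      simp only [disk, if_neg h]
      refine ⟨h5, h6, fun _ => ?_⟩
      rw [him _ _ (by norm_num)]
      exact ⟨fun h => by rw [(h7 rfl).1 h]; simp,
        fun h => mul_le_mul_of_nonneg_left ((h7 rfl).2 h) h2.le⟩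

theorem disk_leftOf {X : Type} {χ : X → Col} {k : Col} (t : Tree χ k) (ht : t.leaves.Nodup) :
    t.leaves.Pairwise fun x y => LeftOf (t.disk x) (t.disk y) := by
  classical
  have h2 : (0 : ℝ) < 1 / 2 := by norm_num
  have key {k : Col} (s t : Tree χ k) (d : X → Disk) (hst : (s.leaves ++ t.leaves).Nodup)
      (hd : ∀ x, d x = if x ∈ s.leaves then Disk.mul (-1 / 2, 1 / 2) (s.disk x) else
        Disk.mul (1 / 2, 1 / 2) (t.disk x))
      (hs : s.leaves.Pairwise fun x y => LeftOf (s.disk x) (s.disk y))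
      (ht : t.leaves.Pairwise fun x y => LeftOf (t.disk x) (t.disk y)) :
      (s.leaves ++ t.leaves).Pairwise fun x y => LeftOf (d x) (d y) := by
    have hdis := List.disjoint_of_nodup_append hst
    refine List.pairwise_append.2 ⟨?_, ?_, ?_⟩
    · refine hs.imp_of_mem fun {x y} hx hy h => ?_
      rw [hd, hd, if_pos hx, if_pos hy]
      exact h.mul h2
    · refine ht.imp_of_mem fun {x y} hx hy h => ?_
      rw [hd, hd, if_neg fun h => hdis h hx, if_neg fun h => hdis h hy]
      exact h.mul h2
    · intro x hx y hy
      rw [hd, hd, if_pos hx, if_neg fun h => hdis h hy]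
      refine LeftOf.mul_mul ?_ h2 h2 (s.disk_spec x hx).2.1 (t.disk_spec y hy).2.1
      norm_num [LeftOf]
  induction t with
  | leaf y => simp [leaves]
  | mulc s t hs iht =>
    exact key s t _ ht (fun x => by simp [disk]) (hs (List.Nodup.of_append_left ht))
      (iht (List.Nodup.of_append_right ht))
  | f s hs => exact (hs ht).imp fun h => h.mul h2
  | mulo s t hs iht =>
    exact key s t _ ht (fun x => by simp [disk]) (hs (List.Nodup.of_append_left ht))
      (iht (List.Nodup.of_append_right ht))

theorem disk_rel {X X' : Type} (e : X → X') (he : Function.Injective e) {χ : X' → Col} {k : Col}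
    (t : Tree (χ ∘ e) k) (x : X) : (t.rel e).disk (e x) = t.disk x := by
  have hm {k : Col} (t : Tree (χ ∘ e) k) : e x ∈ (t.rel e).leaves ↔ x ∈ t.leaves := by
    rw [leaves_rel, List.mem_map_of_injective he]
  induction t with
  | leaf y => rfl
  | mulc s t hs ht =>
    change (mulc (s.rel e) (t.rel e)).disk (e x) = _
    by_cases h : x ∈ s.leaves
    · rw [mulc_disk_pos h, mulc_disk_pos ((hm s).2 h), hs]
    · rw [mulc_disk_neg h, mulc_disk_neg fun h' => h ((hm s).1 h'), ht]
  | f s hs =>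
    change (f (s.rel e)).disk (e x) = _
    simp only [disk, hs]
  | mulo s t hs ht =>
    change (mulo (s.rel e) (t.rel e)).disk (e x) = _
    by_cases h : x ∈ s.leaves
    · rw [mulo_disk_pos h, mulo_disk_pos ((hm s).2 h), hs]
    · rw [mulo_disk_neg h, mulo_disk_neg fun h' => h ((hm s).1 h'), ht]

theorem disk_sub {Y : Type} {X : Y → Type} {χ : Y → Col} {ξ : ∀ y, X y → Col} {k : Col}
    (t : Tree χ k) (u : ∀ y, Tree (ξ y) (χ y)) (y : Y) (x : X y) (hy : y ∈ t.leaves)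
    (hx : x ∈ (u y).leaves) :
    (t.sub u).disk ⟨y, x⟩ = (t.disk y).mul ((u y).disk x) := by
  have hm {k : Col} (t : Tree χ k) :
      (⟨y, x⟩ : (Σ y, X y)) ∈ (t.sub u).leaves ↔ y ∈ t.leaves := by
    rw [leaves_sub, lexList, List.mem_flatMap]
    constructor
    · rintro ⟨y', h, h'⟩
      obtain ⟨x', _, h''⟩ := List.mem_map.1 h'
      obtain rfl : y' = y := congrArg Sigma.fst h''
      exact h
    · exact fun h => ⟨y, h, List.mem_map.2 ⟨x, hx, rfl⟩⟩
  induction t with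
  | leaf y' =>
    obtain rfl : y = y' := by simpa [leaves] using hy
    refine (disk_rel (χ := fun w : (Σ y, X y) => ξ w.1 w.2) (Sigma.mk y) sigma_mk_injective
      (u y) x).trans ?_
    exact (Disk.one_mul _).symm
  | mulc s t hs ht =>
    change (mulc (s.sub u) (t.sub u)).disk _ = _
    by_cases h : y ∈ s.leaves
    · rw [mulc_disk_pos h, mulc_disk_pos ((hm s).2 h), hs h, Disk.mul_assoc]
    · rw [mulc_disk_neg h, mulc_disk_neg fun h' => h ((hm s).1 h'),
        ht ((List.mem_append.1 hy).resolve_left h), Disk.mul_assoc]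
  | f s hs =>
    change (f (s.sub u)).disk _ = _
    simp only [disk, hs hy, Disk.mul_assoc]
  | mulo s t hs ht =>
    change (mulo (s.sub u) (t.sub u)).disk _ = _
    by_cases h : y ∈ s.leaves
    · rw [mulo_disk_pos h, mulo_disk_pos ((hm s).2 h), hs h, Disk.mul_assoc]
    · rw [mulo_disk_neg h, mulo_disk_neg fun h' => h ((hm s).1 h'),
        ht ((List.mem_append.1 hy).resolve_left h), Disk.mul_assoc]

theorem disk_isSC {X : Type} {χ : X → Col} {k : Col} (t : Tree χ k) (ht : IsOrder t.leaves) :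
    IsSC χ k t.disk where
  nonempty := by
    obtain ⟨x, _⟩ := List.exists_mem_of_ne_nil _ t.leaves_ne_nil
    exact ⟨x⟩
  pos x := (t.disk_spec x (ht.2 x)).1
  norm_le x := (t.disk_spec x (ht.2 x)).2.1
  disj := disj_of_pairwise ht (t.disk_leftOf ht.1)
  closed hk x := t.closed_of_mem hk x (ht.2 x)
  half hk x := ((t.disk_spec x (ht.2 x)).2.2 hk).1
  full hk x := ((t.disk_spec x (ht.2 x)).2.2 hk).2

end Tree

/-- The morphism from the free operad to the operad of objects of the fundamental groupoid of the
Swiss-Cheese operad given by the configurations of `μ_c`, `f` and `μ_o`. -/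
noncomputable def magToSC : MagMag.Hom SC.pi.toSetOperad where
  obj t := ⟨⟨t.1.disk, t.1.disk_isSC t.2⟩⟩
  obj_relabel e _ _ t := FundamentalGroupoid.ext <| Subtype.ext <| funext fun x => by
    obtain ⟨x, rfl⟩ := e.surjective x
    refine (t.1.disk_rel e e.injective x).trans ?_
    exact congrArg t.1.disk (e.symm_apply_apply x).symm
  obj_one _ := rfl
  obj_comp p q := FundamentalGroupoid.ext <| Subtype.ext <| funext fun w =>
    p.1.disk_sub (fun y => (q y).1) w.1 w.2 (p.2.2 _) ((q _).2.2 _)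

/-! ## Configurations of points -/

/-- Configurations of points. If the output is open, these are configurations of distinct points
in the upper half disk, with open (terrestrial) points on the real line and closed (aerial) points
above it; if the output is closed, all points are closed and lie in the unit disk. -/
structure IsConf {X : Type} (χ : X → Col) (k : Col) (z : X → ℂ) : Prop where
  nonempty : Nonempty X
  norm_le (x : X) : ‖z x‖ ≤ 1
  inj : Function.Injective z
  closed (h : k = Col.c) (x : X) : χ x = Col.c
  terr (h : k = Col.o) (x : X) : χ x = Col.o → (z x).im = 0
  aer (h : k = Col.o) (x : X) : χ x = Col.c → 0 < (z x).im

/-- The configuration space `Conf(X, χ; k)`. -/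
abbrev ConfSpace (X : Type) (χ : X → Col) (k : Col) : Type := {z : X → ℂ // IsConf χ k z}

section Maps

variable {X : Type} {χ : X → Col} {k : Col}

/-- The map sending each disk to its centre. -/
def centres (X : Type) (χ : X → Col) (k : Col) : C(SCSpace X χ k, ConfSpace X χ k) where
  toFun d := ⟨fun x => (d.1 x).1,
    { nonempty := d.2.nonempty
      norm_le x := by linarith [d.2.norm_le x, d.2.pos x]
      inj x y h := by
        by_contra hne
        have := d.2.disj x y hne
        have h : (d.1 x).1 = (d.1 y).1 := h
        rw [h, sub_self, norm_zero] at this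
        linarith [d.2.pos x, d.2.pos y]
      closed := d.2.closed
      terr := d.2.half
      aer hk x hx := (d.2.pos x).trans_le (d.2.full hk x hx) }⟩
  continuous_toFun := by
    refine Continuous.subtype_mk (continuous_pi fun x => ?_) _
    exact ((continuous_apply x).comp continuous_subtype_val).fst

variable [Finite X]

open Classical in
/-- A positive continuous function of a configuration, at most `1/8` of the distance between any two
points and of the height of any aerial point. -/
noncomputable def gap (χ : X → Col) (k : Col) (z : X → ℂ) : ℝ :=
  let _ := Fintype.ofFinite X
  (1 / 8) * (∏ x : X, ∏ y : X, if x = y then 1 else min 1 ‖z x - z y‖) *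
    ∏ x : X, if k = Col.o ∧ χ x = Col.c then min 1 (z x).im else 1

theorem continuous_gap (χ : X → Col) (k : Col) : Continuous (gap χ k) := by
  classical
  let _ := Fintype.ofFinite X
  unfold gap
  refine (continuous_const.mul (continuous_finsetProd _ fun x _ => continuous_finsetProd _
    fun y _ => ?_)).mul (continuous_finsetProd _ fun x _ => ?_)
  · split_ifs
    · exact continuous_const
    · fun_prop
  · split_ifs
    · exact continuous_const.min (Complex.continuous_im.comp (continuous_apply x))
    · exact continuous_const

theorem gap_spec (z : ConfSpace X χ k) : 0 < gap χ k z.1 ∧ gap χ k z.1 ≤ 1 / 8 ∧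
    (∀ x y, x ≠ y → 8 * gap χ k z.1 ≤ ‖z.1 x - z.1 y‖) ∧
    (k = Col.o → ∀ x, χ x = Col.c → 8 * gap χ k z.1 ≤ (z.1 x).im) := by
  classical
  let _ := Fintype.ofFinite X
  have hprod {ι : Type} (s : Finset ι) (a : ι → ℝ) (ha : ∀ i, 0 < a i ∧ a i ≤ 1) :
      0 < ∏ i ∈ s, a i ∧ (∏ i ∈ s, a i ≤ 1) ∧ ∀ i ∈ s, ∏ i ∈ s, a i ≤ a i := by
    refine ⟨Finset.prod_pos fun i _ => (ha i).1,
      Finset.prod_le_one (fun i _ => (ha i).1.le) fun i _ => (ha i).2, fun i hi => ?_⟩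
    rw [← Finset.mul_prod_erase s a hi]
    exact mul_le_of_le_one_right (ha i).1.le
      (Finset.prod_le_one (fun i _ => (ha i).1.le) fun i _ => (ha i).2)
  have h1 (x y : X) : 0 < (if x = y then 1 else min 1 ‖z.1 x - z.1 y‖) ∧
      (if x = y then 1 else min 1 ‖z.1 x - z.1 y‖) ≤ 1 := by
    split_ifs with h
    · simp
    · exact ⟨lt_min one_pos (norm_pos_iff.2 (sub_ne_zero.2 fun h' => h (z.2.inj h'))),
        min_le_left _ _⟩
  have h2 (x : X) : 0 < (if k = Col.o ∧ χ x = Col.c then min 1 (z.1 x).im else 1) ∧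
      (if k = Col.o ∧ χ x = Col.c then min 1 (z.1 x).im else 1) ≤ 1 := by
    split_ifs with h
    · exact ⟨lt_min one_pos (z.2.aer h.1 x h.2), min_le_left _ _⟩
    · simp
  have hA1 (x : X) := hprod Finset.univ _ fun y => h1 x y
  have hA := hprod Finset.univ _ fun x => ⟨(hA1 x).1, (hA1 x).2.1⟩
  have hB := hprod Finset.univ _ h2
  have hg : gap χ k z.1 = (1 / 8) * (∏ x : X, ∏ y : X, if x = y then 1 else
    min 1 ‖z.1 x - z.1 y‖) * ∏ x : X, if k = Col.o ∧ χ x = Col.c then min 1 (z.1 x).im else 1 := rfl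
  rw [hg]
  obtain ⟨hA2, hA3, hA4⟩ := hA
  obtain ⟨hB2, hB3, hB4⟩ := hB
  refine ⟨by positivity, by nlinarith, fun x y hxy => ?_, fun hk x hx => ?_⟩
  · have h3 := hA4 x (Finset.mem_univ _)
    have h4 := (hA1 x).2.2 y (Finset.mem_univ _)
    rw [if_neg hxy] at h4
    have h5 := min_le_right 1 ‖z.1 x - z.1 y‖
    nlinarith
  · have h3 := hB4 x (Finset.mem_univ _)
    rw [if_pos ⟨hk, hx⟩] at h3
    have h5 := min_le_right 1 (z.1 x).im
    nlinarith

theorem isSC_thicken (z : ConfSpace X χ k) :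
    IsSC χ k fun x => ((z.1 x / 2, gap χ k z.1) : Disk) := by
  obtain ⟨h1, h2, h3, h4⟩ := gap_spec z
  refine ⟨z.2.nonempty, fun x => h1, fun x => ?_, fun x y hxy => ?_, z.2.closed, fun hk x hx => ?_,
    fun hk x hx => ?_⟩
  · have := z.2.norm_le x
    have h : ‖z.1 x / 2‖ = ‖z.1 x‖ / 2 := by simp
    simp only [h]
    linarith
  · have := h3 x y hxy
    have h : ‖z.1 x / 2 - z.1 y / 2‖ = ‖z.1 x - z.1 y‖ / 2 := by rw [← sub_div]; simp
    simp only [h]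
    linarith
  · have := z.2.terr hk x hx
    simp [this]
  · have := h4 hk x hx
    have h : (z.1 x / 2).im = (z.1 x).im / 2 := by simp
    simp only [h]
    linarith

/-- Thickening: after shrinking a configuration by the factor `1/2`, replace its points by small
disks. -/
noncomputable def thicken (X : Type) [Finite X] (χ : X → Col) (k : Col) :
    C(ConfSpace X χ k, SCSpace X χ k) where
  toFun z := ⟨fun x => (z.1 x / 2, gap χ k z.1), isSC_thicken z⟩
  continuous_toFun := by
    refine Continuous.subtype_mk (continuous_pi fun x => ?_) _
    exact (((continuous_apply x).comp continuous_subtype_val).div_const 2).prodMk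
      ((continuous_gap χ k).comp continuous_subtype_val)

/-- The homotopy from the thickening of the centres to the identity. -/
noncomputable def homS (X : Type) [Finite X] (χ : X → Col) (k : Col) :
    ((thicken X χ k).comp (centres X χ k)).Homotopy (ContinuousMap.id _) where
  toFun a := ⟨AffineMap.lineMap ((thicken X χ k) (centres X χ k a.2)).1 a.2.1 (a.1 : ℝ), by
    obtain ⟨⟨t, ht0, ht1⟩, d⟩ := a
    have hT := isSC_thicken (centres X χ k d)
    set ρ := gap χ k (centres X χ k d).1
    have e1 (x : X) : (AffineMap.lineMap ((thicken X χ k) (centres X χ k d)).1 d.1 t x).1 =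
        ((1 + t) / 2 : ℝ) * (d.1 x).1 := by
      simp only [AffineMap.lineMap_apply_module, Pi.add_apply, Pi.smul_apply, Prod.fst_add,
        Prod.smul_fst, Complex.real_smul]
      change ((1 - t : ℝ) : ℂ) * ((d.1 x).1 / 2) + _ = _
      push_cast
      ring
    have e2 (x : X) : (AffineMap.lineMap ((thicken X χ k) (centres X χ k d)).1 d.1 t x).2 =
        (1 - t) * ρ + t * (d.1 x).2 := by
      simp only [AffineMap.lineMap_apply_module, Pi.add_apply, Pi.smul_apply, Prod.snd_add,
        Prod.smul_snd, smul_eq_mul]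
      rfl
    have hn (w : ℂ) : ‖((1 + t) / 2 : ℝ) * w‖ = (1 + t) / 2 * ‖w‖ := by
      rw [norm_mul, Complex.norm_real, Real.norm_of_nonneg (by positivity)]
    obtain ⟨h1, h2, h3, h4⟩ := gap_spec (centres X χ k d)
    change 0 < ρ at h1
    change ρ ≤ _ at h2
    refine ⟨d.2.nonempty, fun x => ?_, fun x => ?_, fun x y hxy => ?_, d.2.closed, fun hk x hx => ?_,
      fun hk x hx => ?_⟩
    · rw [e2]
      have := d.2.pos x
      rcases ht0.eq_or_lt with h | h
      · rw [← h]; simpa using h1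
      · nlinarith [mul_pos h this, mul_nonneg (sub_nonneg.2 ht1) h1.le]
    · rw [e1, e2, hn]
      have := d.2.norm_le x
      have := d.2.pos x
      nlinarith [norm_nonneg (d.1 x).1]
    · rw [e1, e1, e2, e2, ← mul_sub, hn]
      have h5 := d.2.disj x y hxy
      have h6 : 8 * ρ ≤ ‖(d.1 x).1 - (d.1 y).1‖ := h3 x y hxy
      nlinarith
    · rw [e1]
      simp [d.2.half hk x hx]
    · rw [e1, e2, Complex.im_ofReal_mul]
      have h5 := d.2.full hk x hx
      have h6 : 8 * ρ ≤ (d.1 x).1.im := h4 hk x hx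
      nlinarith⟩
  continuous_toFun := by
    refine Continuous.subtype_mk ?_ _
    simp only [AffineMap.lineMap_apply_module]
    have h : Continuous fun a : unitInterval × SCSpace X χ k =>
        ((thicken X χ k) (centres X χ k a.2)).1 :=
      continuous_subtype_val.comp
        (((thicken X χ k).continuous.comp (centres X χ k).continuous).comp continuous_snd)
    have h' : Continuous fun a : unitInterval × SCSpace X χ k => (a.1 : ℝ) :=
      continuous_subtype_val.comp continuous_fst
    exact ((continuous_const.sub h').smul h).add
      (h'.smul (continuous_subtype_val.comp continuous_snd))
  map_zero_left d := Subtype.ext (by simp)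
  map_one_left d := Subtype.ext (by simp)

/-- The homotopy from the identity to the centres of the thickening. -/
noncomputable def homC (X : Type) [Finite X] (χ : X → Col) (k : Col) :
    (ContinuousMap.id _).Homotopy ((centres X χ k).comp (thicken X χ k)) where
  toFun a := ⟨AffineMap.lineMap a.2.1 ((centres X χ k) (thicken X χ k a.2)).1 (a.1 : ℝ), by
    obtain ⟨⟨t, ht0, ht1⟩, z⟩ := a
    have e1 (x : X) : AffineMap.lineMap z.1 ((centres X χ k) (thicken X χ k z)).1 t x =
        (1 - t / 2 : ℝ) * z.1 x := by
      simp only [AffineMap.lineMap_apply_module, Pi.add_apply, Pi.smul_apply, Complex.real_smul]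
      change _ + ((t : ℝ) : ℂ) * (z.1 x / 2) = _
      push_cast
      ring
    have h0 : 0 < 1 - t / 2 := by linarith
    refine ⟨z.2.nonempty, fun x => ?_, fun x y h => ?_, z.2.closed, fun hk x hx => ?_,
      fun hk x hx => ?_⟩
    · rw [e1, norm_mul, Complex.norm_real, Real.norm_of_nonneg h0.le]
      have := z.2.norm_le x
      nlinarith [norm_nonneg (z.1 x)]
    · have h : AffineMap.lineMap z.1 ((centres X χ k) (thicken X χ k z)).1 t x =
        AffineMap.lineMap z.1 ((centres X χ k) (thicken X χ k z)).1 t y := h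
      rw [e1, e1] at h
      exact z.2.inj (mul_left_cancel₀ (Complex.ofReal_ne_zero.2 h0.ne') h)
    · rw [e1, Complex.im_ofReal_mul, z.2.terr hk x hx, mul_zero]
    · rw [e1, Complex.im_ofReal_mul]
      exact mul_pos h0 (z.2.aer hk x hx)⟩
  continuous_toFun := by
    refine Continuous.subtype_mk ?_ _
    simp only [AffineMap.lineMap_apply_module]
    have h : Continuous fun a : unitInterval × ConfSpace X χ k =>
        ((centres X χ k) (thicken X χ k a.2)).1 :=
      continuous_subtype_val.comp
        (((centres X χ k).continuous.comp (thicken X χ k).continuous).comp continuous_snd)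
    have h' : Continuous fun a : unitInterval × ConfSpace X χ k => (a.1 : ℝ) :=
      continuous_subtype_val.comp continuous_fst
    exact ((continuous_const.sub h').smul (continuous_subtype_val.comp continuous_snd)).add
      (h'.smul h)
  map_zero_left d := Subtype.ext (by simp)
  map_one_left d := Subtype.ext (by simp)

end Maps

/-! ## Straight paths in convex pieces -/

section Convex

variable {V W : Type} [AddCommGroup V] [Module ℝ V] [TopologicalSpace V] [ContinuousAdd V]
  [ContinuousSMul ℝ V] {A C : V → Prop} [AddCommGroup W] [Module ℝ W] [TopologicalSpace W]
  [ContinuousAdd W] [ContinuousSMul ℝ W] {B D : W → Prop}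

/-- A convex piece `C` of a subspace `A` of a vector space. -/
structure IsPiece (A C : V → Prop) : Prop where
  convex : Convex ℝ {v | C v}
  sub : ∀ v, C v → A v

/-- The straight path between two points of a convex piece. -/
def IsPiece.path (h : IsPiece A C) {a b : {v // A v}} (ha : C a.1) (hb : C b.1) : Path a b where
  toFun t := ⟨AffineMap.lineMap a.1 b.1 (t : ℝ), h.sub _ (h.convex.lineMap_mem ha hb t.2)⟩
  continuous_toFun := by
    refine Continuous.subtype_mk ?_ _
    simp only [AffineMap.lineMap_apply_module]
    fun_prop
  source' := Subtype.ext (by simp)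
  target' := Subtype.ext (by simp)

/-- The class of the straight path between two points of a convex piece. -/
def IsPiece.hom (h : IsPiece A C) {a b : {v // A v}} (ha : C a.1) (hb : C b.1) :
    FundamentalGroupoid.mk a ⟶ FundamentalGroupoid.mk b :=
  pathHom (h.path ha hb)

theorem IsPiece.pathHom_eq (h : IsPiece A C) {a b : {v // A v}} (p : Path a b)
    (hp : ∀ t, C (p t).1) (ha : C a.1) (hb : C b.1) : pathHom p = h.hom ha hb := by
  refine Quotient.sound ⟨?_⟩
  have hq (t : unitInterval) : C (h.path ha hb t).1 := h.convex.lineMap_mem ha hb t.2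
  refine
    { toFun := fun w => ⟨AffineMap.lineMap (p w.2).1 (h.path ha hb w.2).1 (w.1 : ℝ),
        h.sub _ (h.convex.lineMap_mem (hp _) (hq _) w.1.2)⟩
      continuous_toFun := ?_
      map_zero_left := fun t => Subtype.ext (by simp)
      map_one_left := fun t => Subtype.ext (by simp)
      prop' := ?_ }
  · refine Continuous.subtype_mk ?_ _
    simp only [AffineMap.lineMap_apply_module]
    have h1 : Continuous fun w : unitInterval × unitInterval => (w.1 : ℝ) :=
      continuous_subtype_val.comp continuous_fst
    have h2 : Continuous fun w : unitInterval × unitInterval => (p w.2).1 :=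
      continuous_subtype_val.comp (p.continuous.comp continuous_snd)
    have h3 : Continuous fun w : unitInterval × unitInterval => (h.path ha hb w.2).1 :=
      continuous_subtype_val.comp ((h.path ha hb).continuous.comp continuous_snd)
    exact ((continuous_const.sub h1).smul h2).add (h1.smul h3)
  · rintro t x (rfl | rfl) <;> exact Subtype.ext (by simp)

theorem IsPiece.hom_comp (h : IsPiece A C) {a b c : {v // A v}} (ha : C a.1) (hb : C b.1)
    (hc : C c.1) : h.hom ha hb ≫ h.hom hb hc = h.hom ha hc := by
  refine h.pathHom_eq ((h.path ha hb).trans (h.path hb hc)) (fun t => ?_) ha hc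
  rw [Path.trans_apply]
  split_ifs
  · exact h.convex.lineMap_mem ha hb (Subtype.prop _)
  · exact h.convex.lineMap_mem hb hc (Subtype.prop _)

theorem IsPiece.hom_self (h : IsPiece A C) {a : {v // A v}} (ha : C a.1) :
    h.hom ha ha = 𝟙 _ :=
  (h.pathHom_eq (Path.refl a) (fun _ => ha) ha ha).symm

theorem IsPiece.map_hom (h : IsPiece A C) (h' : IsPiece B D) (F : C({v // A v}, {w // B w}))
    (hF : ∀ a : {v // A v}, C a.1 → D (F a).1) {a b : {v // A v}} (ha : C a.1) (hb : C b.1) :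
    (FundamentalGroupoid.map F).map (h.hom ha hb) = h'.hom (hF a ha) (hF b hb) :=
  h'.pathHom_eq ((h.path ha hb).map F.continuous)
    (fun t => hF _ (h.convex.lineMap_mem ha hb t.2)) _ _

end Convex

/-! ## The operad of coloured permutations and braids -/

/-- The operad of objects of `CoPB`: left-to-right orders of a non-empty set of terrestrial and
aerial points (all points being closed if the output is closed). Composition replaces each point by
an ordered set. -/
def Ord : SetOperad where
  Op X _ χ k := {l : List X // IsOrder l ∧ l ≠ [] ∧ (k = Col.c → ∀ x, χ x = Col.c)}
  relabel e χ k l := ⟨l.1.map e, isOrder_map e l.2.1, by simpa using l.2.2.1,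
    fun hk x => by simpa using l.2.2.2 hk (e.symm x)⟩
  one k := ⟨[()], by simp [IsOrder], by simp, fun hk _ => hk⟩
  comp l m := ⟨lexList l.1 fun y => (m y).1, isOrder_lex l.2.1 fun y => (m y).2.1, by
      obtain ⟨y, hy⟩ := List.exists_mem_of_ne_nil _ l.2.2.1
      obtain ⟨x, hx⟩ := List.exists_mem_of_ne_nil _ (m y).2.2.1
      exact List.ne_nil_of_mem (List.mem_flatMap.2 ⟨y, hy, List.mem_map_of_mem hx⟩),
    fun hk w => (m w.1).2.2.2 (l.2.2.2 hk w.1) w.2⟩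
  relabel_refl l := Subtype.ext (List.map_id _)
  relabel_trans e e' _ _ l := Subtype.ext (List.map_map (f := e) (g := e')).symm
  one_comp l := Subtype.ext <| by
    simp [lexList, Function.comp_def, Equiv.uniqueSigma]
  comp_one l := Subtype.ext <| by
    simp [lexList, List.map_flatMap]
  assoc l m n := Subtype.ext <| by
    simp only [lexList, List.map_flatMap, List.flatMap_assoc, List.flatMap_map, List.map_map]
    rfl
  comp_relabel e _ _ _ l m := Subtype.ext <| by
    simp only [lexList, List.map_flatMap, List.map_map]
    rfl
  relabel_comp e _ _ _ _ _ l m := Subtype.ext <| by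
    simp only [lexList, List.map_flatMap, List.flatMap_map, List.map_map]
    rfl

/-- The morphism `ω`, sending a tree to the sequence of its leaves. -/
def omegaOb : MagMag.Hom Ord where
  obj t := ⟨t.1.leaves, t.2, t.1.leaves_ne_nil, fun hk x => t.1.closed_of_mem hk x (t.2.2 x)⟩
  obj_relabel e _ _ t := Subtype.ext (t.1.leaves_rel e)
  obj_one _ := rfl
  obj_comp t u := Subtype.ext (t.1.leaves_sub fun y => (u y).1)

section Chambers

variable {X : Type} {χ : X → Col} {k : Col} {l : List X}

/-- The points of the configuration `z` lie in the left-to-right order `l`. -/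
def InOrder (χ : X → Col) (k : Col) (l : List X) (z : X → ℂ) : Prop :=
  IsConf χ k z ∧ l.Pairwise fun x y => (z x).re < (z y).re

/-- Points in the left-to-right order `l`, with small slopes. -/
def Flat (χ : X → Col) (k : Col) (l : List X) (z : X → ℂ) : Prop :=
  InOrder χ k l z ∧ l.Pairwise fun x y => |(z x).im - (z y).im| ≤ (z y).re - (z x).re

/-- Horizontally separated disks in the left-to-right order `l`. -/
def Separated (χ : X → Col) (k : Col) (l : List X) (d : X → Disk) : Prop :=
  IsSC χ k d ∧ l.Pairwise fun x y => LeftOf (d x) (d y)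

theorem inj_of_pairwise (hl : IsOrder l) {z : X → ℂ}
    (h : l.Pairwise fun x y => (z x).re < (z y).re) : Function.Injective z := by
  intro x y hxy
  by_contra hne
  have : Std.Symm fun x y => z x ≠ z y := ⟨fun x y h => h.symm⟩
  exact (h.imp fun h h' => h.ne (congrArg Complex.re h') :
    l.Pairwise fun x y => z x ≠ z y).forall (hl.2 x) (hl.2 y) hne hxy

theorem isPiece_inOrder (hl : IsOrder l) : IsPiece (IsConf χ k) (InOrder χ k l) where
  convex := by
    intro z hz w hw a b ha hb hab
    have h1 : l.Pairwise fun x y => ((a • z + b • w) x).re < ((a • z + b • w) y).re := by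
      refine (hz.2.and hw.2).imp fun {x y} h => ?_
      simp only [Pi.add_apply, Pi.smul_apply, Complex.add_re, Complex.smul_re, smul_eq_mul]
      rcases ha.eq_or_lt with h' | h'
      · have : b = 1 := by linarith
        subst this; rw [← h']; linarith [h.2]
      · nlinarith [mul_lt_mul_of_pos_left h.1 h', mul_le_mul_of_nonneg_left h.2.le hb]
    refine ⟨⟨hz.1.nonempty, fun x => ?_, inj_of_pairwise hl h1, hz.1.closed, fun hk x hx => ?_,
      fun hk x hx => ?_⟩, h1⟩
    · have := convex_closedBall (0 : ℂ) 1 (mem_closedBall_zero_iff.2 (hz.1.norm_le x))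
        (mem_closedBall_zero_iff.2 (hw.1.norm_le x)) ha hb hab
      exact mem_closedBall_zero_iff.1 this
    · simp [hz.1.terr hk x hx, hw.1.terr hk x hx]
    · have h2 := hz.1.aer hk x hx
      have h3 := hw.1.aer hk x hx
      simp only [Pi.add_apply, Pi.smul_apply, Complex.add_im, Complex.smul_im, smul_eq_mul]
      rcases ha.eq_or_lt with h' | h'
      · have : b = 1 := by linarith
        subst this; rw [← h']; linarith
      · nlinarith [mul_pos h' h2, mul_nonneg hb h3.le]
  sub _ h := h.1

theorem isPiece_flat (hl : IsOrder l) : IsPiece (IsConf χ k) (Flat χ k l) where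
  convex := by
    intro z hz w hw a b ha hb hab
    refine ⟨(isPiece_inOrder hl).convex hz.1 hw.1 ha hb hab, ?_⟩
    refine (hz.2.and hw.2).imp fun {x y} h => ?_
    obtain ⟨h1, h2⟩ := h
    rw [abs_le] at *
    simp only [Pi.add_apply, Pi.smul_apply, Complex.add_re, Complex.smul_re, smul_eq_mul,
      Complex.add_im, Complex.smul_im]
    constructor <;> nlinarith
  sub _ h := h.1.1

theorem isPiece_separated (hl : IsOrder l) : IsPiece (IsSC χ k) (Separated χ k l) where
  convex := by
    intro d hd e he a b ha hb hab
    have h1 : l.Pairwise fun x y => LeftOf ((a • d + b • e) x) ((a • d + b • e) y) := by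
      refine (hd.2.and he.2).imp fun {x y} h => ?_
      simp only [LeftOf, Pi.add_apply, Pi.smul_apply, Complex.add_re, Complex.smul_re, smul_eq_mul,
        Prod.fst_add, Prod.snd_add, Prod.smul_fst, Prod.smul_snd] at *
      nlinarith [mul_le_mul_of_nonneg_left h.1 ha, mul_le_mul_of_nonneg_left h.2 hb]
    refine ⟨⟨hd.1.nonempty, fun x => ?_, fun x => ?_, disj_of_pairwise hl h1, hd.1.closed,
      fun hk x hx => ?_, fun hk x hx => ?_⟩, h1⟩
    · have h2 := hd.1.pos x
      have h3 := he.1.pos x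
      simp only [Pi.add_apply, Pi.smul_apply, Prod.snd_add, Prod.smul_snd, smul_eq_mul]
      rcases ha.eq_or_lt with h' | h'
      · have : b = 1 := by linarith
        subst this; rw [← h']; linarith
      · nlinarith [mul_pos h' h2, mul_nonneg hb h3.le]
    · have h2 := hd.1.norm_le x
      have h3 := he.1.norm_le x
      simp only [Pi.add_apply, Pi.smul_apply, Prod.snd_add, Prod.smul_snd, smul_eq_mul,
        Prod.fst_add, Prod.smul_fst]
      have h4 := norm_add_le (a • (d x).1) (b • (e x).1)
      rw [norm_smul, norm_smul, Real.norm_of_nonneg ha, Real.norm_of_nonneg hb] at h4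
      nlinarith
    · simp [hd.1.half hk x hx, he.1.half hk x hx]
    · have h2 := hd.1.full hk x hx
      have h3 := he.1.full hk x hx
      simp only [Pi.add_apply, Pi.smul_apply, Prod.snd_add, Prod.smul_snd, smul_eq_mul,
        Prod.fst_add, Prod.smul_fst, Complex.add_im, Complex.smul_im]
      nlinarith [mul_le_mul_of_nonneg_left h2 ha, mul_le_mul_of_nonneg_left h3 hb]
  sub _ h := h.1

theorem inOrder_centres (d : SCSpace X χ k) (h : Separated χ k l d.1) :
    InOrder χ k l (centres X χ k d).1 := by
  refine ⟨(centres X χ k d).2, h.2.imp fun {x y} h' => ?_⟩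
  change (d.1 x).1.re < (d.1 y).1.re
  have := d.2.pos x
  have := d.2.pos y
  simp only [LeftOf] at h'
  linarith

theorem separated_thicken [Finite X] (z : ConfSpace X χ k) (h : Flat χ k l z.1) :
    Separated χ k l (thicken X χ k z).1 := by
  refine ⟨(thicken X χ k z).2, (h.1.2.and h.2).imp fun {x y} h' => ?_⟩
  obtain ⟨h1, h2⟩ := h'
  obtain ⟨-, -, h3, -⟩ := gap_spec z
  have h4 := h3 x y (fun h => by rw [h] at h1; exact lt_irrefl _ h1)
  have h5 := Complex.norm_le_abs_re_add_abs_im (z.1 x - z.1 y)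
  rw [Complex.sub_re, Complex.sub_im, abs_sub_comm (z.1 x).re, abs_of_pos (sub_pos.2 h1)] at h5
  change (z.1 x / 2).re + gap χ k z.1 ≤ (z.1 y / 2).re - gap χ k z.1
  have e (w : ℂ) : (w / 2).re = w.re / 2 := by simp
  rw [e, e]
  linarith

theorem flat_half [Finite X] (z : ConfSpace X χ k) (h : Flat χ k l z.1) :
    Flat χ k l (centres X χ k (thicken X χ k z)).1 := by
  have e1 (x : X) : ((centres X χ k (thicken X χ k z)).1 x).re = (z.1 x).re / 2 := by
    change (z.1 x / 2).re = _; simp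
  have e2 (x : X) : ((centres X χ k (thicken X χ k z)).1 x).im = (z.1 x).im / 2 := by
    change (z.1 x / 2).im = _; simp
  refine ⟨⟨(centres X χ k (thicken X χ k z)).2, h.1.2.imp fun {x y} h' => ?_⟩,
    h.2.imp fun {x y} h' => ?_⟩
  · rw [e1, e1]; linarith
  · rw [e1, e1, e2, e2, abs_le]
    rw [abs_le] at h'
    constructor <;> linarith

end Chambers

section Base

variable {X : Type} [Finite X] {χ : X → Col} {k : Col}

open Classical in
/-- The base configuration `c⁰` of an order on `n` points: the abscissas of the points are
`-1 + 1/n, -1 + 3/n, …, 1 - 1/n`, and the height of the aerial points is `1/(2n)`. (If the output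
is closed all points are on the real axis.) -/
noncomputable def baseFun (χ : X → Col) (k : Col) (l : List X) (x : X) : ℂ :=
  ⟨(2 * (l.idxOf x : ℝ) + 1) / l.length - 1,
    if k = Col.o ∧ χ x = Col.c then 1 / (2 * (l.length : ℝ)) else 0⟩

theorem flat_baseFun (l : Ord.Op X χ k) : Flat χ k l.1 (baseFun χ k l.1) := by
  classical
  obtain ⟨l, hl, hne, hk⟩ := l
  change Flat χ k l (baseFun χ k l)
  have hpos : 0 < l.length := List.length_pos_of_ne_nil hne
  have hn : (1 : ℝ) ≤ l.length := by exact_mod_cast hpos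
  have hn' : (0 : ℝ) < l.length := by linarith
  have him (x : X) : 0 ≤ (baseFun χ k l x).im ∧
      (baseFun χ k l x).im ≤ 1 / (2 * (l.length : ℝ)) := by
    unfold baseFun
    simp only
    split_ifs
    · exact ⟨by positivity, le_rfl⟩
    · exact ⟨le_rfl, by positivity⟩
  have hre (x : X) : (baseFun χ k l x).re = (2 * (l.idxOf x : ℝ) + 1) / l.length - 1 := by
    unfold baseFun
    simp only

  have hidx : l.Pairwise fun x y => l.idxOf x < l.idxOf y := by
    rw [List.pairwise_iff_getElem]
    intro i j hi hj hij
    rwa [hl.1.idxOf_getElem, hl.1.idxOf_getElem]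
  have hgap : l.Pairwise fun x y => 2 / (l.length : ℝ) ≤
      (baseFun χ k l y).re - (baseFun χ k l x).re := by
    refine hidx.imp fun {x y} h => ?_
    have h' : (l.idxOf x : ℝ) + 1 ≤ l.idxOf y := by exact_mod_cast h
    rw [hre, hre, sub_sub_sub_cancel_right, ← sub_div]
    gcongr
    linarith
  have hord : l.Pairwise fun x y => (baseFun χ k l x).re < (baseFun χ k l y).re := by
    refine hgap.imp fun {x y} h => ?_
    have : 0 < 2 / (l.length : ℝ) := by positivity
    linarith
  refine ⟨⟨⟨?_, fun x => ?_, inj_of_pairwise hl hord, hk, fun hk x hx => ?_, fun hk x hx => ?_⟩,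
    hord⟩, hgap.imp fun {x y} h => ?_⟩
  · obtain ⟨x, _⟩ := List.exists_mem_of_ne_nil _ hne
    exact ⟨x⟩
  · have h1 : (l.idxOf x : ℝ) + 1 ≤ l.length := by
      exact_mod_cast List.idxOf_lt_length_of_mem (hl.2 x)
    have h2 : |(baseFun χ k l x).re| ≤ 1 - 1 / l.length := by
      rw [hre, abs_le]
      constructor
      · rw [neg_sub, sub_le_sub_iff_right]
        gcongr
        linarith [(l.idxOf x).cast_nonneg (α := ℝ)]
      · rw [sub_le_iff_le_add, div_le_iff₀ hn']
        have : (1 - 1 / (l.length : ℝ) + 1) * l.length = 2 * l.length - 1 := by field_simp; ring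
        rw [this]
        linarith
    have h3 : |(baseFun χ k l x).im| ≤ 1 / l.length := by
      rw [abs_of_nonneg (him x).1]
      refine (him x).2.trans ?_
      gcongr
      linarith
    linarith [Complex.norm_le_abs_re_add_abs_im (baseFun χ k l x)]
  · unfold baseFun
    simp [hx]
  · unfold baseFun
    simp only [hk, hx, and_self, if_true]
    positivity
  · have h1 := him x
    have h2 := him y
    have h3 : 1 / (2 * (l.length : ℝ)) ≤ 2 / l.length := by
      rw [div_le_div_iff₀ (by positivity) hn']
      linarith
    rw [abs_le]
    constructor <;> linarith

/-- The base configuration of an order, as a point of the configuration space. -/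
noncomputable def base (l : Ord.Op X χ k) : ConfSpace X χ k :=
  ⟨baseFun χ k l.1, (flat_baseFun l).1.1⟩

end Base

section Braid

variable {X : Type} [Finite X] {χ : X → Col} {k : Col}

/-- The canonical path class between two configurations in the same left-to-right order `l`, given
by the straight path. -/
noncomputable def straight (l : Ord.Op X χ k) {z w : ConfSpace X χ k} (hz : InOrder χ k l.1 z.1)
    (hw : InOrder χ k l.1 w.1) : FundamentalGroupoid.mk z ⟶ FundamentalGroupoid.mk w :=
  (isPiece_inOrder l.2.1).hom hz hw

/-- The canonical path class between separated configurations of disks. -/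
noncomputable def straightS (l : Ord.Op X χ k) {d e : SCSpace X χ k} (hd : Separated χ k l.1 d.1)
    (he : Separated χ k l.1 e.1) : FundamentalGroupoid.mk d ⟶ FundamentalGroupoid.mk e :=
  (isPiece_separated l.2.1).hom hd he

theorem base_inOrder (l : Ord.Op X χ k) : InOrder χ k l.1 (base l).1 := (flat_baseFun l).1

/-- The thickened base configuration. -/
noncomputable def thickBase (l : Ord.Op X χ k) : SCSpace X χ k := thicken X χ k (base l)

theorem thickBase_separated (l : Ord.Op X χ k) : Separated χ k l.1 (thickBase l).1 :=
  separated_thicken _ (flat_baseFun l)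

/-- Thickening of path classes of configurations. -/
noncomputable def thickenMap {z w : ConfSpace X χ k}
    (f : FundamentalGroupoid.mk z ⟶ FundamentalGroupoid.mk w) :
    FundamentalGroupoid.mk (thicken X χ k z) ⟶ FundamentalGroupoid.mk (thicken X χ k w) :=
  (FundamentalGroupoid.map (thicken X χ k)).map f

/-- Centres of path classes of configurations of disks. -/
noncomputable def centresMap {d e : SCSpace X χ k}
    (f : FundamentalGroupoid.mk d ⟶ FundamentalGroupoid.mk e) :
    FundamentalGroupoid.mk (centres X χ k d) ⟶ FundamentalGroupoid.mk (centres X χ k e) :=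
  (FundamentalGroupoid.map (centres X χ k)).map f

theorem separated_relabel {X' : Type} [Finite X'] (e : X ≃ X') {χ : X' → Col}
    (l : Ord.Op X (χ ∘ e) k) {d : SCSpace X (χ ∘ e) k} (h : Separated (χ ∘ e) k l.1 d.1) :
    Separated χ k (Ord.relabel e l).1 (SC.relabel e d).1 := by
  refine ⟨(SC.relabel e d).2, ?_⟩
  change (l.1.map e).Pairwise fun x y => LeftOf (d.1 (e.symm x)) (d.1 (e.symm y))
  rw [List.pairwise_map]
  simpa using h.2

theorem separated_one (k : Col) : Separated (fun _ => k) k (Ord.one k).1 (SC.one k).1 :=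
  ⟨(SC.one k).2, List.pairwise_singleton _ _⟩

theorem separated_comp {Y : Type} [Finite Y] {X : Y → Type} [∀ y, Finite (X y)] {χ : Y → Col}
    {ξ : ∀ y, X y → Col} (l : Ord.Op Y χ k) (m : ∀ y, Ord.Op (X y) (ξ y) (χ y))
    {d : SCSpace Y χ k} {e : ∀ y, SCSpace (X y) (ξ y) (χ y)} (hd : Separated χ k l.1 d.1)
    (he : ∀ y, Separated (ξ y) (χ y) (m y).1 (e y).1) :
    Separated (fun w : (Σ y, X y) => ξ w.1 w.2) k (Ord.comp l m).1 (SC.comp d e).1 := by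
  refine ⟨(SC.comp d e).2, ?_⟩
  change (lexList l.1 fun y => (m y).1).Pairwise fun v w =>
    LeftOf ((d.1 v.1).mul ((e v.1).1 v.2)) ((d.1 w.1).mul ((e w.1).1 w.2))
  unfold lexList
  rw [List.pairwise_flatMap]
  refine ⟨fun y _ => ?_, hd.2.imp fun {y y'} h v hv w hw => ?_⟩
  · rw [List.pairwise_map]
    exact (he y).2.imp fun h => h.mul (d.2.pos y)
  · obtain ⟨x, _, rfl⟩ := List.mem_map.1 hv
    obtain ⟨x', _, rfl⟩ := List.mem_map.1 hw
    exact h.mul_mul (d.2.pos y) (d.2.pos y') ((e y).2.norm_le x) ((e y').2.norm_le x')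

/-- Relabelling of configurations. -/
def confRelabel {X' : Type} (e : X ≃ X') (χ : X' → Col) (k : Col) :
    C(ConfSpace X (χ ∘ e) k, ConfSpace X' χ k) where
  toFun z := ⟨z.1 ∘ e.symm,
    { nonempty := z.2.nonempty.map e
      norm_le x := z.2.norm_le _
      inj := z.2.inj.comp e.symm.injective
      closed hk x := by simpa using z.2.closed hk (e.symm x)
      terr hk x hx := z.2.terr hk (e.symm x) (by simpa using hx)
      aer hk x hx := z.2.aer hk (e.symm x) (by simpa using hx) }⟩
  continuous_toFun := by
    refine Continuous.subtype_mk (continuous_pi fun x => ?_) _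
    exact (continuous_apply (e.symm x)).comp continuous_subtype_val

theorem inOrder_relabel {X' : Type} [Finite X'] (e : X ≃ X') {χ : X' → Col}
    (l : Ord.Op X (χ ∘ e) k) {z : ConfSpace X (χ ∘ e) k} (h : InOrder (χ ∘ e) k l.1 z.1) :
    InOrder χ k (Ord.relabel e l).1 (confRelabel e χ k z).1 := by
  refine ⟨(confRelabel e χ k z).2, ?_⟩
  change (l.1.map e).Pairwise fun x y => (z.1 (e.symm x)).re < (z.1 (e.symm y)).re
  rw [List.pairwise_map]
  simpa using h.2

/-- Morphisms of `CoPB`: path classes in the configuration space between base configurations. -/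
abbrev Braid (l m : Ord.Op X χ k) : Type :=
  FundamentalGroupoid.mk (base l) ⟶ FundamentalGroupoid.mk (base m)

/-- Relabelling of a braid. (The straight paths are constant, as relabelling preserves base
configurations.) -/
noncomputable def braidRelabel {X' : Type} [Finite X'] (e : X ≃ X') {χ : X' → Col} {k : Col}
    {l m : Ord.Op X (χ ∘ e) k} (f : Braid l m) : Braid (Ord.relabel e l) (Ord.relabel e m) :=
  straight (Ord.relabel e l) (base_inOrder _) (inOrder_relabel e l (base_inOrder l)) ≫
    (FundamentalGroupoid.map (confRelabel e χ k)).map f ≫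
    straight (Ord.relabel e m) (inOrder_relabel e m (base_inOrder m)) (base_inOrder _)

/-- Operadic composition of braids: the braids `g y` are inserted into tubular neighbourhoods of the
strands of `f`, given by thickening the points of all configurations to small disks and composing
disks in the Swiss-Cheese operad. The ends are moved to base configurations along straight paths,
which preserve the left-to-right order of the points. -/
noncomputable def braidComp {Y : Type} [Finite Y] {X : Y → Type} [∀ y, Finite (X y)] {χ : Y → Col}
    {ξ : ∀ y, X y → Col} {k : Col} {l l' : Ord.Op Y χ k} {m m' : ∀ y, Ord.Op (X y) (ξ y) (χ y)}
    (f : Braid l l') (g : ∀ y, Braid (m y) (m' y)) : Braid (Ord.comp l m) (Ord.comp l' m') :=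
  straight (Ord.comp l m) (base_inOrder _) (inOrder_centres _
      (separated_comp l m (thickBase_separated l) fun y => thickBase_separated (m y))) ≫
    centresMap (SC.pi.compMap (thickenMap f) fun y => thickenMap (g y)) ≫
    straight (Ord.comp l' m') (inOrder_centres _
      (separated_comp l' m' (thickBase_separated l') fun y => thickBase_separated (m' y)))
      (base_inOrder _)

/-- The braid traced by the centres of a path of configurations of disks with separated ends. -/
noncomputable def braidOf (l m : Ord.Op X χ k) {d e : SCSpace X χ k} (hd : Separated χ k l.1 d.1)
    (he : Separated χ k m.1 e.1) (u : FundamentalGroupoid.mk d ⟶ FundamentalGroupoid.mk e) :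
    Braid l m :=
  straight l (base_inOrder l) (inOrder_centres d hd) ≫ centresMap u ≫
    straight m (inOrder_centres e he) (base_inOrder m)

theorem centresMap_straightS (l : Ord.Op X χ k) {d e : SCSpace X χ k}
    (hd : Separated χ k l.1 d.1) (he : Separated χ k l.1 e.1) :
    centresMap (straightS l hd he) = straight l (inOrder_centres d hd) (inOrder_centres e he) :=
  (isPiece_separated l.2.1).map_hom (isPiece_inOrder l.2.1) (centres X χ k)
    (fun a h => inOrder_centres a h) hd he

theorem straight_comp (l : Ord.Op X χ k) {z w v : ConfSpace X χ k} (hz : InOrder χ k l.1 z.1)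
    (hw : InOrder χ k l.1 w.1) (hv : InOrder χ k l.1 v.1) :
    straight l hz hw ≫ straight l hw hv = straight l hz hv :=
  (isPiece_inOrder l.2.1).hom_comp hz hw hv

theorem straight_comp_assoc (l : Ord.Op X χ k) {z w v : ConfSpace X χ k}
    (hz : InOrder χ k l.1 z.1) (hw : InOrder χ k l.1 w.1) (hv : InOrder χ k l.1 v.1)
    {a : FundamentalGroupoid (ConfSpace X χ k)} (f : FundamentalGroupoid.mk v ⟶ a) :
    straight l hz hw ≫ straight l hw hv ≫ f = straight l hz hv ≫ f := by
  rw [← Category.assoc, straight_comp]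

theorem straight_self (l : Ord.Op X χ k) {z : ConfSpace X χ k} (hz : InOrder χ k l.1 z.1) :
    straight l hz hz = 𝟙 _ :=
  (isPiece_inOrder l.2.1).hom_self hz

theorem straightS_comp (l : Ord.Op X χ k) {z w v : SCSpace X χ k} (hz : Separated χ k l.1 z.1)
    (hw : Separated χ k l.1 w.1) (hv : Separated χ k l.1 v.1) :
    straightS l hz hw ≫ straightS l hw hv = straightS l hz hv :=
  (isPiece_separated l.2.1).hom_comp hz hw hv

theorem straightS_self (l : Ord.Op X χ k) {z : SCSpace X χ k} (hz : Separated χ k l.1 z.1) :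
    straightS l hz hz = 𝟙 _ :=
  (isPiece_separated l.2.1).hom_self hz

theorem thickCentres_separated (l : Ord.Op X χ k) :
    Separated χ k l.1 (thicken X χ k (centres X χ k (thickBase l))).1 :=
  separated_thicken _ (flat_half _ (flat_baseFun l))

theorem thicken_straight (l : Ord.Op X χ k) :
    thickenMap (straight l (base_inOrder l) (inOrder_centres _ (thickBase_separated l))) =
      straightS l (thickBase_separated l) (thickCentres_separated l) := by
  have h1 : straight l (base_inOrder l) (inOrder_centres _ (thickBase_separated l)) =
      (isPiece_flat l.2.1).hom (flat_baseFun l) (flat_half (base l) (flat_baseFun l)) :=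
    ((isPiece_inOrder l.2.1).pathHom_eq _
      (fun t => ((isPiece_flat l.2.1).convex.lineMap_mem (flat_baseFun l)
        (flat_half (base l) (flat_baseFun l)) t.2).1) _ _).symm
  rw [h1]
  exact (isPiece_flat l.2.1).map_hom (isPiece_separated l.2.1) (thicken X χ k)
    (fun a h => separated_thicken a h) _ _

/-- The path class from the thickening of the centres of `d` to `d`. -/
noncomputable def pathS (d : SCSpace X χ k) :
    FundamentalGroupoid.mk (thicken X χ k (centres X χ k d)) ⟶ FundamentalGroupoid.mk d :=
  pathHom (a := thicken X χ k (centres X χ k d)) (b := d) ((homS X χ k).evalAt d)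

/-- The path class from `z` to the centres of the thickening of `z`. -/
noncomputable def pathC (z : ConfSpace X χ k) :
    FundamentalGroupoid.mk z ⟶ FundamentalGroupoid.mk (centres X χ k (thicken X χ k z)) :=
  pathHom (a := z) (b := centres X χ k (thicken X χ k z)) ((homC X χ k).evalAt z)

theorem pathS_natural {d e : SCSpace X χ k}
    (u : FundamentalGroupoid.mk d ⟶ FundamentalGroupoid.mk e) :
    thickenMap (centresMap u) ≫ pathS e = pathS d ≫ u := by
  obtain ⟨p, rfl⟩ := pathHom_surj u
  exact Quotient.sound (Path.Homotopic.map_trans_evalAt (homS X χ k) p)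

theorem pathC_natural {z w : ConfSpace X χ k}
    (f : FundamentalGroupoid.mk z ⟶ FundamentalGroupoid.mk w) :
    f ≫ pathC w = pathC z ≫ centresMap (thickenMap f) := by
  obtain ⟨p, rfl⟩ := pathHom_surj f
  exact Quotient.sound (Path.Homotopic.map_trans_evalAt (homC X χ k) p)

theorem pathS_base (l : Ord.Op X χ k) : pathS (thickBase l) =
    straightS l (thickCentres_separated l) (thickBase_separated l) :=
  (isPiece_separated l.2.1).pathHom_eq (a := thicken X χ k (centres X χ k (thickBase l)))
    (b := thickBase l) ((homS X χ k).evalAt (thickBase l))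
    (fun t => (isPiece_separated l.2.1).convex.lineMap_mem
      (thickCentres_separated l) (thickBase_separated l) t.2) _ _

theorem pathC_base (l : Ord.Op X χ k) : pathC (base l) =
    straight l (base_inOrder l) (inOrder_centres _ (thickBase_separated l)) :=
  (isPiece_inOrder l.2.1).pathHom_eq (a := base l)
    (b := centres X χ k (thicken X χ k (base l))) ((homC X χ k).evalAt (base l))
    (fun t => (isPiece_inOrder l.2.1).convex.lineMap_mem
      (base_inOrder l) (inOrder_centres _ (thickBase_separated l)) t.2) _ _

theorem thickenMap_comp {z w v : ConfSpace X χ k}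
    (f : FundamentalGroupoid.mk z ⟶ FundamentalGroupoid.mk w)
    (g : FundamentalGroupoid.mk w ⟶ FundamentalGroupoid.mk v) :
    thickenMap (f ≫ g) = thickenMap f ≫ thickenMap g :=
  (FundamentalGroupoid.map (thicken X χ k)).map_comp f g

theorem centresMap_comp {z w v : SCSpace X χ k}
    (f : FundamentalGroupoid.mk z ⟶ FundamentalGroupoid.mk w)
    (g : FundamentalGroupoid.mk w ⟶ FundamentalGroupoid.mk v) :
    centresMap (f ≫ g) = centresMap f ≫ centresMap g :=
  (FundamentalGroupoid.map (centres X χ k)).map_comp f g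

theorem braidOf_thicken {l m : Ord.Op X χ k} (f : Braid l m) :
    braidOf l m (thickBase_separated l) (thickBase_separated m) (thickenMap f) = f := by
  have h := pathC_natural f
  rw [pathC_base, pathC_base] at h
  unfold braidOf
  rw [← Category.assoc]
  refine (congrArg (· ≫ _) h.symm).trans ?_
  refine (Category.assoc _ _ _).trans ?_
  refine (congrArg (f ≫ ·) (straight_comp m _ _ _)).trans ?_
  refine (congrArg (f ≫ ·) (straight_self m _)).trans ?_
  exact Category.comp_id f

theorem braidOf_base (l m : Ord.Op X χ k) {d e : SCSpace X χ k} (hd : Separated χ k l.1 d.1)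
    (he : Separated χ k m.1 e.1) (u : FundamentalGroupoid.mk d ⟶ FundamentalGroupoid.mk e) :
    braidOf l m hd he u = braidOf l m (thickBase_separated l) (thickBase_separated m)
      (straightS l (thickBase_separated l) hd ≫ u ≫ straightS m he (thickBase_separated m)) := by
  unfold braidOf
  rw [centresMap_comp, centresMap_comp, centresMap_straightS, centresMap_straightS]
  simp only [Category.assoc]
  rw [straight_comp_assoc, straight_comp]

theorem thicken_straight' (l : Ord.Op X χ k) :
    thickenMap (straight l (inOrder_centres _ (thickBase_separated l)) (base_inOrder l)) =
      straightS l (thickCentres_separated l) (thickBase_separated l) := by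
  have h1 : straight l (inOrder_centres _ (thickBase_separated l)) (base_inOrder l) =
      (isPiece_flat l.2.1).hom (flat_half (base l) (flat_baseFun l)) (flat_baseFun l) :=
    ((isPiece_inOrder l.2.1).pathHom_eq _
      (fun t => ((isPiece_flat l.2.1).convex.lineMap_mem
        (flat_half (base l) (flat_baseFun l)) (flat_baseFun l) t.2).1) _ _).symm
  rw [h1]
  exact (isPiece_flat l.2.1).map_hom (isPiece_separated l.2.1) (thicken X χ k)
    (fun a h => separated_thicken a h) _ _

theorem thicken_braidOf (l m : Ord.Op X χ k) {d e : SCSpace X χ k} (hd : Separated χ k l.1 d.1)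
    (he : Separated χ k m.1 e.1) (u : FundamentalGroupoid.mk d ⟶ FundamentalGroupoid.mk e) :
    thickenMap (braidOf l m hd he u) = straightS l (thickBase_separated l) hd ≫ u ≫
      straightS m he (thickBase_separated m) := by
  rw [braidOf_base]
  set w := straightS l (thickBase_separated l) hd ≫ u ≫ straightS m he (thickBase_separated m)
  unfold braidOf
  rw [thickenMap_comp, thickenMap_comp, thicken_straight, thicken_straight']
  have h := pathS_natural w
  rw [pathS_base, pathS_base] at h
  refine (congrArg (_ ≫ ·) h).trans ?_
  refine (Category.assoc _ _ _).symm.trans ?_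
  refine (congrArg (· ≫ w) ((straightS_comp l _ _ _).trans (straightS_self l _))).trans ?_
  exact Category.id_comp w

end Braid

section Laws

variable {X : Type} [Finite X] {χ : X → Col} {k : Col}

/-- The groupoid of coloured permutations and braids with inputs `X`. -/
@[reducible] noncomputable def braidGrpd (X : Type) [Finite X] (χ : X → Col) (k : Col) :
    Groupoid (Ord.Op X χ k) where
  Hom l m := Braid l m
  id l := 𝟙 (FundamentalGroupoid.mk (base l))
  comp f g := f ≫ g
  inv f := Groupoid.inv f

/-- A braid, as an arrow of the groupoid of coloured permutations and braids. -/
noncomputable def mkB {l m : Ord.Op X χ k} (f : Braid l m) :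
    @Arrow (Ord.Op X χ k) (braidGrpd X χ k).toCategory :=
  @Arrow.mk (Ord.Op X χ k) (braidGrpd X χ k).toCategory l m f

theorem mkB_congr {l m l' m' : Ord.Op X χ k} {d e d' e' : SCSpace X χ k}
    {hd : Separated χ k l.1 d.1} {he : Separated χ k m.1 e.1}
    {hd' : Separated χ k l'.1 d'.1} {he' : Separated χ k m'.1 e'.1}
    {u : FundamentalGroupoid.mk d ⟶ FundamentalGroupoid.mk e}
    {u' : FundamentalGroupoid.mk d' ⟶ FundamentalGroupoid.mk e'} (hl : l = l') (hm : m = m')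
    (h : Arrow.mk u = Arrow.mk u') :
    mkB (braidOf l m hd he u) = mkB (braidOf l' m' hd' he' u') := by
  subst hl hm
  obtain ⟨h1, h2, h3⟩ := mk_eq_mk.1 h
  obtain rfl : d = d' := congrArg FundamentalGroupoid.as h1
  obtain rfl : e = e' := congrArg FundamentalGroupoid.as h2
  rw [eq_of_heq h3]

theorem braidOf_id (l : Ord.Op X χ k) {d : SCSpace X χ k} (hd : Separated χ k l.1 d.1) :
    braidOf l l hd hd (𝟙 (FundamentalGroupoid.mk d)) = 𝟙 (FundamentalGroupoid.mk (base l)) := by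
  have h : centresMap (𝟙 (FundamentalGroupoid.mk d)) = 𝟙 _ :=
    (FundamentalGroupoid.map (centres X χ k)).map_id _
  unfold braidOf
  rw [h]
  refine (congrArg (_ ≫ ·) (Category.id_comp _)).trans ?_
  exact (straight_comp l _ _ _).trans (straight_self l _)

theorem braidOf_trans (l m n : Ord.Op X χ k) {d e f : SCSpace X χ k}
    (hd : Separated χ k l.1 d.1) (he : Separated χ k m.1 e.1) (hf : Separated χ k n.1 f.1)
    (u : FundamentalGroupoid.mk d ⟶ FundamentalGroupoid.mk e)
    (v : FundamentalGroupoid.mk e ⟶ FundamentalGroupoid.mk f) :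
    braidOf l n hd hf (u ≫ v) = braidOf l m hd he u ≫ braidOf m n he hf v := by
  unfold braidOf
  rw [centresMap_comp]
  simp only [Category.assoc]
  rw [straight_comp_assoc, straight_self, Category.id_comp]

theorem braidOf_insert (l m : Ord.Op X χ k) {d e d' e' : SCSpace X χ k}
    (hd : Separated χ k l.1 d.1) (he : Separated χ k m.1 e.1)
    (hd' : Separated χ k l.1 d'.1) (he' : Separated χ k m.1 e'.1)
    (u : FundamentalGroupoid.mk d ⟶ FundamentalGroupoid.mk e) :
    braidOf l m hd' he' (straightS l hd' hd ≫ u ≫ straightS m he he') = braidOf l m hd he u := by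
  unfold braidOf
  rw [centresMap_comp, centresMap_comp, centresMap_straightS, centresMap_straightS]
  simp only [Category.assoc]
  rw [straight_comp_assoc, straight_comp]

section

variable {Y : Type} [Finite Y] {X : Y → Type} [∀ y, Finite (X y)] {χ : Y → Col}
  {ξ : ∀ y, X y → Col}

theorem comp_straightS (l : Ord.Op Y χ k) (m : ∀ y, Ord.Op (X y) (ξ y) (χ y))
    {d d' : SCSpace Y χ k} {e e' : ∀ y, SCSpace (X y) (ξ y) (χ y)}
    (hd : Separated χ k l.1 d.1) (he : ∀ y, Separated (ξ y) (χ y) (m y).1 (e y).1)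
    (hd' : Separated χ k l.1 d'.1) (he' : ∀ y, Separated (ξ y) (χ y) (m y).1 (e' y).1) :
    SC.pi.compMap (straightS l hd hd') (fun y => straightS (m y) (he y) (he' y)) =
      straightS (Ord.comp l m) (separated_comp l m hd he) (separated_comp l m hd' he') := by
  refine (SC.piComp_mk (p := ⟨d⟩) (p' := ⟨d'⟩) (q := fun y => ⟨e y⟩) (q' := fun y => ⟨e' y⟩)
    ((isPiece_separated l.2.1).path hd hd')
    fun y => (isPiece_separated (m y).2.1).path (he y) (he' y)).trans ?_
  refine (isPiece_separated (Ord.comp l m).2.1).pathHom_eq (a := SC.comp d e)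
    (b := SC.comp d' e') _ (fun t => ?_) _ _
  exact separated_comp l m
    (d := (isPiece_separated l.2.1).path hd hd' t)
    (e := fun y => (isPiece_separated (m y).2.1).path (he y) (he' y) t)
    ((isPiece_separated l.2.1).convex.lineMap_mem hd hd' t.2)
    fun y => (isPiece_separated (m y).2.1).convex.lineMap_mem (he y) (he' y) t.2

theorem braidComp_braidOf (l l' : Ord.Op Y χ k) (m m' : ∀ y, Ord.Op (X y) (ξ y) (χ y))
    {d d' : SCSpace Y χ k} {e e' : ∀ y, SCSpace (X y) (ξ y) (χ y)}
    (hd : Separated χ k l.1 d.1) (he : ∀ y, Separated (ξ y) (χ y) (m y).1 (e y).1)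
    (hd' : Separated χ k l'.1 d'.1) (he' : ∀ y, Separated (ξ y) (χ y) (m' y).1 (e' y).1)
    (u : FundamentalGroupoid.mk d ⟶ FundamentalGroupoid.mk d')
    (v : ∀ y, FundamentalGroupoid.mk (e y) ⟶ FundamentalGroupoid.mk (e' y)) :
    braidComp (braidOf l l' hd hd' u) (fun y => braidOf (m y) (m' y) (he y) (he' y) (v y)) =
      braidOf (Ord.comp l m) (Ord.comp l' m') (separated_comp l m hd he)
        (separated_comp l' m' hd' he') (SC.pi.compMap u v) := by
  have h1 := thicken_braidOf l l' hd hd' u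
  have h2 := fun y => thicken_braidOf (m y) (m' y) (he y) (he' y) (v y)
  have h3 : SC.pi.compMap (thickenMap (braidOf l l' hd hd' u))
      (fun y => thickenMap (braidOf (m y) (m' y) (he y) (he' y) (v y))) =
      straightS (Ord.comp l m)
        (separated_comp l m (thickBase_separated l) fun y => thickBase_separated (m y))
        (separated_comp l m hd he) ≫ SC.pi.compMap u v ≫
      straightS (Ord.comp l' m') (separated_comp l' m' hd' he')
        (separated_comp l' m' (thickBase_separated l') fun y => thickBase_separated (m' y)) := by
    rw [h1, funext h2]
    refine (SC.pi.compMap_comp (straightS l _ hd) (u ≫ straightS l' hd' _)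
      (fun y => straightS (m y) _ (he y)) (fun y => v y ≫ straightS (m' y) (he' y) _)).trans ?_
    refine congrArg₂ (· ≫ ·) (comp_straightS l m _ _ _ _) ?_
    refine (SC.pi.compMap_comp u (straightS l' hd' _) v
      (fun y => straightS (m' y) (he' y) _)).trans ?_
    exact congrArg (_ ≫ ·) (comp_straightS l' m' _ _ _ _)
  exact (congrArg (braidOf (Ord.comp l m) (Ord.comp l' m') _ _) h3).trans
    (braidOf_insert _ _ _ _ _ _ _)

theorem braidComp_eq {l l' : Ord.Op Y χ k} {m m' : ∀ y, Ord.Op (X y) (ξ y) (χ y)}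
    (f : Braid l l') (g : ∀ y, Braid (m y) (m' y)) :
    braidComp f g = braidOf (Ord.comp l m) (Ord.comp l' m')
      (separated_comp l m (thickBase_separated l) fun y => thickBase_separated (m y))
      (separated_comp l' m' (thickBase_separated l') fun y => thickBase_separated (m' y))
      (SC.pi.compMap (thickenMap f) fun y => thickenMap (g y)) := rfl

end

theorem braidRelabel_braidOf {X' : Type} [Finite X'] (e : X ≃ X') {χ : X' → Col}
    (l m : Ord.Op X (χ ∘ e) k) {d d' : SCSpace X (χ ∘ e) k}
    (hd : Separated (χ ∘ e) k l.1 d.1) (hd' : Separated (χ ∘ e) k m.1 d'.1)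
    (u : FundamentalGroupoid.mk d ⟶ FundamentalGroupoid.mk d') :
    braidRelabel e (braidOf l m hd hd' u) =
      braidOf (Ord.relabel e l) (Ord.relabel e m) (separated_relabel e l hd)
        (separated_relabel e m hd') (SC.pi.relabelMap e u) := by
  have h1 (n : Ord.Op X (χ ∘ e) k) {z w : ConfSpace X (χ ∘ e) k}
      (hz : InOrder (χ ∘ e) k n.1 z.1) (hw : InOrder (χ ∘ e) k n.1 w.1) :
      (FundamentalGroupoid.map (confRelabel e χ k)).map (straight n hz hw) =
      straight (Ord.relabel e n) (inOrder_relabel e n hz) (inOrder_relabel e n hw) :=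
    (isPiece_inOrder n.2.1).map_hom (isPiece_inOrder (Ord.relabel e n).2.1) (confRelabel e χ k)
      (fun a h => inOrder_relabel e n h) hz hw
  have h2 : (FundamentalGroupoid.map (confRelabel e χ k)).map (centresMap u) =
      centresMap (SC.pi.relabelMap e u) := by
    obtain ⟨p, rfl⟩ := pathHom_surj u
    rfl
  have h3 : (FundamentalGroupoid.map (confRelabel e χ k)).map (braidOf l m hd hd' u) =
      straight (Ord.relabel e l) (inOrder_relabel e l (base_inOrder l))
        (inOrder_relabel e l (inOrder_centres d hd)) ≫ centresMap (SC.pi.relabelMap e u) ≫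
      straight (Ord.relabel e m) (inOrder_relabel e m (inOrder_centres d' hd'))
        (inOrder_relabel e m (base_inOrder m)) := by
    unfold braidOf
    rw [Functor.map_comp, Functor.map_comp, h1, h1]
    exact congrArg (fun a => _ ≫ a ≫ _) h2
  refine (congrArg (fun a => straight (Ord.relabel e l) _ _ ≫ a ≫
    straight (Ord.relabel e m) _ _) h3).trans ?_
  simp only [Category.assoc]
  refine (straight_comp_assoc (Ord.relabel e l) _ _ _ _).trans ?_
  refine congrArg (straight (Ord.relabel e l) _ _ ≫ ·) ?_
  refine (Category.assoc _ _ _).trans ?_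
  exact congrArg (centresMap (SC.pi.relabelMap e u) ≫ ·)
    (straight_comp (Ord.relabel e m) _ _ _)

theorem braidRelabel_eq {X' : Type} [Finite X'] (e : X ≃ X') {χ : X' → Col}
    {l m : Ord.Op X (χ ∘ e) k} (f : Braid l m) :
    braidRelabel e f = braidOf (Ord.relabel e l) (Ord.relabel e m)
      (separated_relabel e l (thickBase_separated l))
      (separated_relabel e m (thickBase_separated m)) (SC.pi.relabelMap e (thickenMap f)) :=
  (congrArg (braidRelabel e) (braidOf_thicken f).symm).trans (braidRelabel_braidOf e l m _ _ _)

end Laws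

/-- The operad `CoPB` of coloured permutations and braids: its objects are left-to-right orders of
points, its morphisms are path classes of configurations of points between base configurations, and
its composition is insertion of braids into tubular neighbourhoods of strands. -/
noncomputable def CoPB : GrpdOperad where
  toSetOperad := Ord
  grpd X _ χ k := braidGrpd X χ k
  relabelMap e _ _ _ _ f := braidRelabel e f
  compMap f g := braidComp f g
  relabelMap_id e _ _ l := by
    refine (congrArg (braidRelabel e) (braidOf_id l (thickBase_separated l)).symm).trans ?_
    refine (braidRelabel_braidOf e l l _ _ _).trans ?_
    refine (congrArg (braidOf (Ord.relabel e l) (Ord.relabel e l) _ _)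
      (SC.pi.relabelMap_id e _)).trans ?_
    exact braidOf_id _ _
  relabelMap_comp {X _} _ _ e χ k l m n (f : Braid l m) (g : Braid m n) := by
    have h (l m : Ord.Op X (χ ∘ e) k) (f : Braid l m) := (congrArg (braidRelabel e) (braidOf_thicken f).symm).trans
      (braidRelabel_braidOf e l m _ _ (thickenMap f))
    refine (h l n (f ≫ g)).trans ?_
    refine Eq.trans ?_ (congrArg₂ (· ≫ ·) (h l m f) (h m n g)).symm
    refine Eq.trans ?_ (braidOf_trans _ _ _ _ _ _ _ _)
    refine congrArg (braidOf (Ord.relabel e l) (Ord.relabel e n) _ _) ?_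
    exact (congrArg (SC.pi.relabelMap e) (thickenMap_comp f g)).trans
      (SC.pi.relabelMap_comp e _ _)
  compMap_id {Y} _ {X} _ {χ ξ k} l m := by
    have h1 := (braidOf_id l (thickBase_separated l)).symm
    have h2 := fun y => (braidOf_id (m y) (thickBase_separated (m y))).symm
    refine (congrArg₂ (fun a b => braidComp (l := l) (l' := l) (m := m) (m' := m) a b) h1
      (funext h2)).trans ?_
    refine (braidComp_braidOf l l m m _ _ _ _ _ _).trans ?_
    refine (congrArg (braidOf (Ord.comp l m) (Ord.comp l m) _ _)
      (SC.pi.compMap_id _ _)).trans ?_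
    exact braidOf_id _ _
  compMap_comp {Y} _ {X} _ {χ ξ k} l l' l'' m m' m'' (f : Braid l l') (f' : Braid l' l'')
      (g : ∀ y, Braid (m y) (m' y)) (g' : ∀ y, Braid (m' y) (m'' y)) := by
    have s (l : Ord.Op Y χ k) (m : ∀ y, Ord.Op (X y) (ξ y) (χ y)) :=
      separated_comp l m (thickBase_separated l) fun y => thickBase_separated (m y)
    refine (congrArg (braidOf (Ord.comp l m) (Ord.comp l'' m'') (s l m) (s l'' m'')) ?_).trans
      (braidOf_trans (Ord.comp l m) (Ord.comp l' m') (Ord.comp l'' m'') (s l m) (s l' m')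
        (s l'' m'') _ _)
    refine (congrArg₂ (fun a b => SC.pi.compMap a b) (thickenMap_comp f f')
      (funext fun y => thickenMap_comp (g y) (g' y))).trans ?_
    exact SC.pi.compMap_comp _ _ _ _
  relabelMap_refl {X} _ χ k l m (f : Braid l m) := by
    refine (congrArg (fun f => mkB (braidRelabel (χ := χ) (Equiv.refl X) f))
      (braidOf_thicken f).symm).trans ?_
    refine (congrArg mkB (braidRelabel_braidOf (χ := χ) (Equiv.refl X) l m _ _ _)).trans ?_
    refine Eq.trans ?_ (congrArg mkB (braidOf_thicken f))
    exact mkB_congr (Ord.relabel_refl l) (Ord.relabel_refl m)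
      (SC.pi.relabelMap_refl (thickenMap f))
  relabelMap_trans e e' χ k l m (f : Braid l m) := by
    refine (congrArg (fun f => mkB (braidRelabel (χ := χ) (e.trans e') f))
      (braidOf_thicken f).symm).trans ?_
    refine Eq.trans ?_ (congrArg (fun f => mkB (braidRelabel e' (braidRelabel e f)))
      (braidOf_thicken f))
    refine (congrArg mkB (braidRelabel_braidOf (χ := χ) (e.trans e') l m _ _ _)).trans ?_
    refine Eq.trans ?_ (congrArg (fun f => mkB (braidRelabel e' f))
      (braidRelabel_braidOf e l m _ _ _)).symm
    refine Eq.trans ?_ (congrArg mkB (braidRelabel_braidOf e' _ _ _ _ _)).symm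
    exact mkB_congr (Ord.relabel_trans e e' l) (Ord.relabel_trans e e' m)
      (SC.pi.relabelMap_trans e e' (thickenMap f))
  one_compMap {X} _ χ k l m (f : Braid l m) := by
    have h : braidComp (𝟙 (FundamentalGroupoid.mk (base (Ord.one k)))) (fun _ : Unit => f) =
        braidOf _ _ (separated_comp (Ord.one k) (fun _ : Unit => l) (separated_one k)
          fun _ => thickBase_separated l)
          (separated_comp (Ord.one k) (fun _ : Unit => m) (separated_one k)
          fun _ => thickBase_separated m)
          (SC.pi.compMap (𝟙 (SC.pi.one k)) fun _ : Unit => thickenMap f) :=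
      (congrArg₂ (fun a b => braidComp (Y := Unit) (l := Ord.one k) (l' := Ord.one k)
        (m := fun _ => l) (m' := fun _ => m) a b)
        (braidOf_id (Ord.one k) (separated_one k)).symm
        (funext fun _ => (braidOf_thicken f).symm)).trans
      (braidComp_braidOf (Ord.one k) (Ord.one k) _ _ _ _ _ _ _ _)
    refine (congrArg (fun f => mkB (braidRelabel (χ := χ)
      (Equiv.uniqueSigma fun _ : Unit => X) f)) h).trans ?_
    refine (congrArg mkB (braidRelabel_braidOf (χ := χ)
      (Equiv.uniqueSigma fun _ : Unit => X) _ _ _ _ _)).trans ?_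
    refine Eq.trans ?_ (congrArg mkB (braidOf_thicken f))
    exact mkB_congr (Ord.one_comp l) (Ord.one_comp m)
      (SC.pi.one_compMap (thickenMap f))
  compMap_one {X} _ χ k l m (f : Braid l m) := by
    have h : braidComp f (fun x : X => 𝟙 (FundamentalGroupoid.mk (base (Ord.one (χ x))))) =
        braidOf _ _ (separated_comp l (fun x => Ord.one (χ x)) (thickBase_separated l)
          fun x => separated_one (χ x))
          (separated_comp m (fun x => Ord.one (χ x)) (thickBase_separated m)
          fun x => separated_one (χ x))
          (SC.pi.compMap (thickenMap f) fun x : X => 𝟙 (SC.pi.one (χ x))) :=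
      (congrArg₂ (fun a b => braidComp (Y := X) (l := l) (l' := m)
        (m := fun x => Ord.one (χ x)) (m' := fun x => Ord.one (χ x)) a b)
        (braidOf_thicken f).symm
        (funext fun x => (braidOf_id (Ord.one (χ x)) (separated_one (χ x))).symm)).trans
      (braidComp_braidOf l m _ _ _ _ _ _ _ _)
    refine (congrArg (fun f => mkB (braidRelabel (χ := χ)
      (Equiv.sigmaUnique X fun _ => Unit) f)) h).trans ?_
    refine (congrArg mkB (braidRelabel_braidOf (χ := χ)
      (Equiv.sigmaUnique X fun _ => Unit) _ _ _ _ _)).trans ?_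
    refine Eq.trans ?_ (congrArg mkB (braidOf_thicken f))
    exact mkB_congr (Ord.comp_one l) (Ord.comp_one m)
      (SC.pi.compMap_one (thickenMap f))
  assocMap {Y} _ {X} _ {Z} _ χ ξ ζ k l l' m m' n n' (f : Braid l l')
      (g : ∀ y, Braid (m y) (m' y)) (h : ∀ y x, Braid (n y x) (n' y x)) := by
    have h1 := (congrArg₂ (fun a b => braidComp (Y := Σ y, X y) (l := Ord.comp l m)
        (l' := Ord.comp l' m') (m := fun w => n w.1 w.2) (m' := fun w => n' w.1 w.2) a b)
        (braidComp_eq f g) (funext fun w : (Σ y, X y) => (braidOf_thicken (h w.1 w.2)).symm)).trans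
      (braidComp_braidOf (Ord.comp l m) (Ord.comp l' m') (fun w => n w.1 w.2)
        (fun w => n' w.1 w.2) _ _ _ _ _ _)
    have h2 := (congrArg₂ (fun a b => braidComp (Y := Y) (l := l)
        (l' := l') (m := fun y => Ord.comp (m y) (n y)) (m' := fun y => Ord.comp (m' y) (n' y)) a b)
        (braidOf_thicken f).symm (funext fun y => braidComp_eq (g y) (h y))).trans
      (braidComp_braidOf l l' (fun y => Ord.comp (m y) (n y)) (fun y => Ord.comp (m' y) (n' y))
        _ _ _ _ _ _)
    refine (congrArg (fun f => mkB (braidRelabel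
      (χ := fun v : (Σ y, Σ x, Z y x) => ζ v.1 v.2.1 v.2.2) (Equiv.sigmaAssoc Z) f)) h1).trans ?_
    refine Eq.trans ?_ (congrArg mkB h2).symm
    refine (congrArg mkB (braidRelabel_braidOf
      (χ := fun v : (Σ y, Σ x, Z y x) => ζ v.1 v.2.1 v.2.2) (Equiv.sigmaAssoc Z)
      _ _ _ _ _)).trans ?_
    exact mkB_congr (Ord.assoc l m n) (Ord.assoc l' m' n')
      (SC.pi.assocMap (thickenMap f) (fun y => thickenMap (g y)) fun y x => thickenMap (h y x))
  compMap_relabel {Y} _ {X X'} _ _ e χ ξ k l l' m m' (f : Braid l l')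
      (g : ∀ y, Braid (m y) (m' y)) := by
    have h1 := (congrArg₂ (fun a b => braidComp (Y := Y) (l := l)
        (l' := l') (m := fun y => Ord.relabel (e y) (m y))
        (m' := fun y => Ord.relabel (e y) (m' y)) a b)
        (braidOf_thicken f).symm (funext fun y => braidRelabel_eq (e y) (g y))).trans
      (braidComp_braidOf l l' (fun y => Ord.relabel (e y) (m y))
        (fun y => Ord.relabel (e y) (m' y)) _ _ _ _ _ _)
    have h2 := (congrArg (braidRelabel (χ := fun v : (Σ y, X' y) => ξ v.1 v.2)
      (Equiv.sigmaCongrRight e)) (braidComp_eq f g)).trans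
      (braidRelabel_braidOf (χ := fun v : (Σ y, X' y) => ξ v.1 v.2)
        (Equiv.sigmaCongrRight e) (Ord.comp l m) (Ord.comp l' m') _ _ _)
    refine (congrArg mkB h1).trans (Eq.trans ?_ (congrArg mkB h2).symm)
    exact mkB_congr (Ord.comp_relabel e l m) (Ord.comp_relabel e l' m')
      (SC.pi.compMap_relabel e (thickenMap f) fun y => thickenMap (g y))
  relabelMap_compMap {Y Y'} _ _ e {X} _ {χ ξ k} l l' m m' (f : Braid l l')
      (g : ∀ y, Braid (m y) (m' y)) := by
    have h1 := (congrArg₂ (fun a b => braidComp (Y := Y') (l := Ord.relabel e l)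
        (l' := Ord.relabel e l') (m := m) (m' := m') a b)
        (braidRelabel_eq e f) (funext fun y => (braidOf_thicken (g y)).symm)).trans
      (braidComp_braidOf (Ord.relabel e l) (Ord.relabel e l') m m' _ _ _ _ _ _)
    have h2 := (congrArg (braidRelabel (χ := fun v : (Σ y, X y) => ξ v.1 v.2)
      (Equiv.sigmaCongrLeft e)) (braidComp_eq f fun y => g (e y))).trans
      (braidRelabel_braidOf (χ := fun v : (Σ y, X y) => ξ v.1 v.2)
        (Equiv.sigmaCongrLeft e) (Ord.comp l fun y => m (e y)) (Ord.comp l' fun y => m' (e y)) _ _ _)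
    refine (congrArg mkB h1).trans (Eq.trans ?_ (congrArg mkB h2).symm)
    exact mkB_congr (Ord.relabel_comp e l m) (Ord.relabel_comp e l' m')
      (SC.pi.relabelMap_compMap e (thickenMap f) fun y => thickenMap (g y))

/-- The morphism `ω` from the free operad on `μ_c`, `f` and `μ_o` to the objects of `CoPB`. -/
def omega : MagMag.Hom CoPB.toSetOperad := omegaOb

/-- The operad `PaPB = ω^* CoPB` of parenthesized permutations and braids. -/
noncomputable def PaPB : GrpdOperad := CoPB.pullback omega

/-- The canonical morphism `PaPB → CoPB`. -/
noncomputable def papbToCopb : PaPB.Hom CoPB := CoPB.pullbackProj omega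

/-- The restriction of the fundamental groupoid of the Swiss-Cheese operad to the image of the free
operad on `μ_c`, `f` and `μ_o`: the full suboperad on these objects. -/
noncomputable def piSCMag : GrpdOperad := SC.pi.pullback magToSC.imageIncl

/-- The inclusion of the restriction to the image of the free operad. -/
noncomputable def piSCMagIncl : piSCMag.Hom SC.pi := SC.pi.pullbackProj magToSC.imageIncl

end SwissCheese

/-!
The theorem compares paths of configurations of disks with braids, arity by arity, through the
homotopy equivalence `centres : SC → Conf` with homotopy inverse `thicken`.

The morphism `i` is injective because a configuration remembers its tree (`Tree.heq_of_disk`): only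
`leaf` has a disk of radius `1`; the disks of `f s` have their centres at height exactly `1 / 2`,
since the products by `μ_c` have real centres, while those of `mulo s t` lie strictly lower; and the
left and right factors of a product are separated by the sign of the real parts of the centres.

Both projections from the pulled back operads are fully faithful by construction, so only essential
surjectivity is at stake. Every order of the inputs is the sequence of leaves of a comb, which deals
with `PaPB → CoPB`. Every configuration of points can be sheared horizontally, within the
configuration space, to one with distinct abscissas, and from there moves straight to a base
configuration (`exists_hom_base`); thickening this path, a configuration of disks is joined to a
configuration of `i` with the same order, as horizontally separated configurations form a convex
set.

A path between two configurations of `i` is sent to the braid of its centres, closed up by straight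
paths at the ends (`braidOf`). This is bijective on path classes because centres and thickening are
homotopy inverse (`braidOf_bijective`). It is compatible with relabelling and with composition, the
latter because braids are composed by thickening them (`braidRelabel_braidOf`, `braidComp_braidOf`).
A morphism of operads in groupoids that is bijective on objects and on morphisms is an isomorphism.
-/

namespace SwissCheese

/-! ### Injectivity of the morphism from the free operad -/

theorem Disk.mul_right_injective {a : Disk} (ha : 0 < a.2) : Function.Injective a.mul := by
  intro d e h
  have h1 := congrArg Prod.fst h
  have h2 := congrArg Prod.snd h
  simp only [Disk.mul] at h1 h2
  exact Prod.ext (mul_left_cancel₀ (Complex.ofReal_ne_zero.2 ha.ne') (add_left_cancel h1))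
    (mul_left_cancel₀ ha.ne' h2)

namespace Tree

variable {X : Type} {χ : X → Col} {k : Col}

theorem re_left_neg (s : Tree χ k) {x : X} (hx : x ∈ s.leaves) :
    (Disk.mul (-1 / 2, 1 / 2) (s.disk x)).1.re < 0 := by
  obtain ⟨h1, h2, -⟩ := s.disk_spec x hx
  have h3 := (abs_le.1 (Complex.abs_re_le_norm (s.disk x).1)).2
  have h4 : (Disk.mul (-1 / 2, 1 / 2) (s.disk x)).1.re = -1 / 2 + 1 / 2 * (s.disk x).1.re := by
    simp [Disk.mul]
  linarith

theorem re_right_pos (s : Tree χ k) {x : X} (hx : x ∈ s.leaves) :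
    0 < (Disk.mul (1 / 2, 1 / 2) (s.disk x)).1.re := by
  obtain ⟨h1, h2, -⟩ := s.disk_spec x hx
  have h3 := (abs_le.1 (Complex.abs_re_le_norm (s.disk x).1)).1
  have h4 : (Disk.mul (1 / 2, 1 / 2) (s.disk x)).1.re = 1 / 2 + 1 / 2 * (s.disk x).1.re := by
    simp [Disk.mul]
  linarith

theorem radius_mul_lt_one (s : Tree χ k) {x : X} (hx : x ∈ s.leaves) (a : ℂ) :
    (Disk.mul (a, 1 / 2) (s.disk x)).2 < 1 := by
  obtain ⟨h1, h2, -⟩ := s.disk_spec x hx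
  have := norm_nonneg (s.disk x).1
  simp only [Disk.mul]
  linarith

/-- Only the tree `leaf` has a disk of radius `1`. -/
theorem eq_leaf_of_radius (t : Tree χ k) {x : X} (hx : x ∈ t.leaves) (h : (t.disk x).2 = 1) :
    t ≍ leaf (χ := χ) x := by
  cases t with
  | leaf y =>
    obtain rfl : x = y := by simpa [leaves] using hx
    rfl
  | mulc s t =>
    by_cases h' : x ∈ s.leaves
    · rw [mulc_disk_pos h'] at h
      exact absurd h (s.radius_mul_lt_one h' _).ne
    · rw [mulc_disk_neg h'] at h
      exact absurd h (t.radius_mul_lt_one ((List.mem_append.1 hx).resolve_left h') _).ne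
  | f s => exact absurd h (s.radius_mul_lt_one hx _).ne
  | mulo s t =>
    by_cases h' : x ∈ s.leaves
    · rw [mulo_disk_pos h'] at h
      exact absurd h (s.radius_mul_lt_one h' _).ne
    · rw [mulo_disk_neg h'] at h
      exact absurd h (t.radius_mul_lt_one ((List.mem_append.1 hx).resolve_left h') _).ne

/-- The centres of a product of disks by `μ_c` are real. -/
theorem disk_im_closed (t : Tree χ k) (hk : k = Col.c) {x : X} (hx : x ∈ t.leaves) :
    (t.disk x).1.im = 0 := by
  have him (a d : Disk) (ha : a.1.im = 0) (hd : d.1.im = 0) : (a.mul d).1.im = 0 := by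
    simp [Disk.mul, ha, hd]
  induction t with
  | leaf y => simp [disk]
  | mulc s t hs ht =>
    by_cases h : x ∈ s.leaves
    · rw [mulc_disk_pos h]
      exact him _ _ (by norm_num) (hs rfl h)
    · rw [mulc_disk_neg h]
      exact him _ _ (by norm_num) (ht rfl ((List.mem_append.1 hx).resolve_left h))
  | f s hs => cases hk
  | mulo s t hs ht => cases hk

theorem disk_im_f (s : Tree χ Col.c) {x : X} (hx : x ∈ s.leaves) :
    ((f s).disk x).1.im = 1 / 2 := by
  simp [disk, Disk.mul, s.disk_im_closed rfl hx]

theorem disk_im_mulo (s t : Tree χ Col.o) {x : X} (hx : x ∈ (mulo s t).leaves) :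
    ((mulo s t).disk x).1.im < 1 / 2 := by
  have key (s : Tree χ Col.o) (hx : x ∈ s.leaves) (a : Disk) (ha : a.1.im = 0)
      (ha' : a.2 = 1 / 2) : (a.mul (s.disk x)).1.im < 1 / 2 := by
    obtain ⟨h1, h2, -⟩ := s.disk_spec x hx
    have h3 := (abs_le.1 (Complex.abs_im_le_norm (s.disk x).1)).2
    have h4 : (a.mul (s.disk x)).1.im = 1 / 2 * (s.disk x).1.im := by simp [Disk.mul, ha, ha']
    linarith
  by_cases h : x ∈ s.leaves
  · rw [mulo_disk_pos h]
    exact key s h _ (by norm_num) rfl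
  · rw [mulo_disk_neg h]
    exact key t ((List.mem_append.1 hx).resolve_left h) _ (by norm_num) rfl

theorem f_disk_ne_mulo_disk (s : Tree χ Col.c) (t u : Tree χ Col.o)
    (hm : ∀ x, x ∈ (f s).leaves ↔ x ∈ (mulo t u).leaves)
    (hd : ∀ x ∈ (f s).leaves, (f s).disk x = (mulo t u).disk x) : False := by
  obtain ⟨x, hx⟩ := List.exists_mem_of_ne_nil _ (f s).leaves_ne_nil
  have h := disk_im_mulo t u ((hm x).1 hx)
  rw [← hd x hx, disk_im_f s hx] at h
  exact lt_irrefl _ h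

/-- The configuration of a product determines those of the two factors: the disks of the left factor
are the ones whose centres have negative real part. -/
theorem factors_of_disk {s t s' t' : Tree χ k} {d d' : X → Disk}
    (hl : ∀ x ∈ s.leaves, d x = Disk.mul (-1 / 2, 1 / 2) (s.disk x))
    (hr : ∀ x ∉ s.leaves, d x = Disk.mul (1 / 2, 1 / 2) (t.disk x))
    (hl' : ∀ x ∈ s'.leaves, d' x = Disk.mul (-1 / 2, 1 / 2) (s'.disk x))
    (hr' : ∀ x ∉ s'.leaves, d' x = Disk.mul (1 / 2, 1 / 2) (t'.disk x))
    (hn : (s.leaves ++ t.leaves).Nodup) (hn' : (s'.leaves ++ t'.leaves).Nodup)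
    (hm : ∀ x, x ∈ s.leaves ++ t.leaves ↔ x ∈ s'.leaves ++ t'.leaves)
    (hd : ∀ x ∈ s.leaves ++ t.leaves, d x = d' x) :
    ((∀ x, x ∈ s.leaves ↔ x ∈ s'.leaves) ∧ ∀ x ∈ s.leaves, s.disk x = s'.disk x) ∧
      (∀ x, x ∈ t.leaves ↔ x ∈ t'.leaves) ∧ ∀ x ∈ t.leaves, t.disk x = t'.disk x := by
  have hdis := List.disjoint_of_nodup_append hn
  have hdis' := List.disjoint_of_nodup_append hn'
  have h2 : (0 : ℝ) < 1 / 2 := by norm_num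
  have hr1 (x : X) (hx : x ∈ t.leaves) := hr x fun h => hdis h hx
  have hr1' (x : X) (hx : x ∈ t'.leaves) := hr' x fun h => hdis' h hx
  -- a leaf common to a left factor and a right factor would have a centre of both signs
  have hs (x : X) : x ∈ s.leaves ↔ x ∈ s'.leaves := by
    constructor
    · intro hx
      have hx1 := List.mem_append_left t.leaves hx
      refine (List.mem_append.1 ((hm x).1 hx1)).resolve_right fun hx' => ?_
      have h3 := s.re_left_neg hx
      rw [← hl x hx, hd x hx1, hr1' x hx'] at h3
      exact h3.not_gt (t'.re_right_pos hx')
    · intro hx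
      have hx1 := (hm x).2 (List.mem_append_left t'.leaves hx)
      refine (List.mem_append.1 hx1).resolve_right fun hx' => ?_
      have h3 := s'.re_left_neg hx
      rw [← hl' x hx, ← hd x hx1, hr1 x hx'] at h3
      exact h3.not_gt (t.re_right_pos hx')
  have ht (x : X) : x ∈ t.leaves ↔ x ∈ t'.leaves := by
    have h := hm x
    rw [List.mem_append, List.mem_append, hs x] at h
    have h3 : x ∈ s'.leaves → x ∉ t.leaves := fun h hx => hdis ((hs x).2 h) hx
    have h4 : x ∈ s'.leaves → x ∉ t'.leaves := fun h hx => hdis' h hx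
    tauto
  refine ⟨⟨hs, fun x hx => ?_⟩, ht, fun x hx => ?_⟩
  · have h := hd x (List.mem_append_left _ hx)
    rw [hl x hx, hl' x ((hs x).1 hx)] at h
    exact Disk.mul_right_injective h2 h
  · have h := hd x (List.mem_append_right _ hx)
    rw [hr1 x hx, hr1' x ((ht x).1 hx)] at h
    exact Disk.mul_right_injective h2 h

/-- A tree without repeated variables is determined by its variables and their disks. The output
colours are allowed to differ by an equation, since the colour of `leaf x` is not a variable. -/
theorem heq_of_disk {k' : Col} (s : Tree χ k) (t : Tree χ k') (hk : k = k')
    (hs : s.leaves.Nodup) (ht : t.leaves.Nodup) (hm : ∀ x, x ∈ s.leaves ↔ x ∈ t.leaves)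
    (hd : ∀ x ∈ s.leaves, s.disk x = t.disk x) : s ≍ t := by
  have hleaf {k : Col} (u : Tree χ k) (x : X) (hx : x ∈ u.leaves)
      (h : u.disk x = (leaf (χ := χ) x).disk x) : u ≍ leaf (χ := χ) x :=
    u.eq_leaf_of_radius hx (congrArg Prod.snd h)
  induction s generalizing k' with
  | leaf x =>
    have hx : x ∈ (leaf (χ := χ) x).leaves := List.mem_singleton_self x
    exact (hleaf t x ((hm x).1 hx) (hd x hx).symm).symm
  | mulc s₁ s₂ ih₁ ih₂ =>
    cases t with
    | leaf x =>
      have hx := (hm x).2 (List.mem_singleton_self x)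
      exact hleaf _ x hx (hd x hx)
    | mulc t₁ t₂ =>
      obtain ⟨⟨a, b⟩, c, d⟩ := factors_of_disk (fun _ => mulc_disk_pos) (fun _ => mulc_disk_neg)
        (fun _ => mulc_disk_pos) (fun _ => mulc_disk_neg) hs ht hm hd
      rw [eq_of_heq (ih₁ t₁ rfl (List.Nodup.of_append_left hs) (List.Nodup.of_append_left ht) a b),
        eq_of_heq (ih₂ t₂ rfl (List.Nodup.of_append_right hs) (List.Nodup.of_append_right ht) c d)]
    | f t => cases hk
    | mulo t₁ t₂ => cases hk
  | f s ih =>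
    cases t with
    | leaf x =>
      have hx := (hm x).2 (List.mem_singleton_self x)
      exact hleaf _ x hx (hd x hx)
    | mulc t₁ t₂ => cases hk
    | f t =>
      rw [eq_of_heq (ih t rfl hs ht hm fun x hx =>
        Disk.mul_right_injective (by norm_num) (hd x hx))]
    | mulo t₁ t₂ => exact (f_disk_ne_mulo_disk s t₁ t₂ hm hd).elim
  | mulo s₁ s₂ ih₁ ih₂ =>
    cases t with
    | leaf x =>
      have hx := (hm x).2 (List.mem_singleton_self x)
      exact hleaf _ x hx (hd x hx)
    | mulc t₁ t₂ => cases hk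
    | f t =>
      exact (f_disk_ne_mulo_disk t s₁ s₂ (fun x => (hm x).symm)
        fun x hx => (hd x ((hm x).2 hx)).symm).elim
    | mulo t₁ t₂ =>
      obtain ⟨⟨a, b⟩, c, d⟩ := factors_of_disk (fun _ => mulo_disk_pos) (fun _ => mulo_disk_neg)
        (fun _ => mulo_disk_pos) (fun _ => mulo_disk_neg) hs ht hm hd
      rw [eq_of_heq (ih₁ t₁ rfl (List.Nodup.of_append_left hs) (List.Nodup.of_append_left ht) a b),
        eq_of_heq (ih₂ t₂ rfl (List.Nodup.of_append_right hs) (List.Nodup.of_append_right ht) c d)]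

end Tree

theorem magToSC_obj_injective {X : Type} [Finite X] {χ : X → Col} {k : Col} :
    Function.Injective fun u : MagMag.Op X χ k => magToSC.obj u := by
  intro u v h
  have h1 : u.1.disk = v.1.disk :=
    congrArg (fun a : FundamentalGroupoid (SCSpace X χ k) => a.as.1) h
  exact Subtype.ext <| eq_of_heq <| u.1.heq_of_disk v.1 rfl u.2.1 v.2.1
    (fun x => ⟨fun _ => v.2.2 x, fun _ => u.2.2 x⟩) fun x _ => congrFun h1 x

/-! ### Trees with a prescribed order of leaves -/

theorem exists_tree_leaves {X : Type} {χ : X → Col} {k : Col} {l : List X} (hl : l ≠ [])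
    (hk : k = Col.c → ∀ x, χ x = Col.c) : ∃ t : Tree χ k, t.leaves = l := by
  have hone (x : X) : ∃ t : Tree χ k, t.leaves = [x] := by
    cases hx : χ x with
    | c =>
      cases k with
      | c => exact hx ▸ ⟨Tree.leaf x, rfl⟩
      | o =>
        obtain ⟨t, ht⟩ : ∃ t : Tree χ Col.c, t.leaves = [x] := hx ▸ ⟨Tree.leaf x, rfl⟩
        exact ⟨Tree.f t, ht⟩
    | o =>
      cases k with
      | c => rw [hk rfl x] at hx; cases hx
      | o => exact hx ▸ ⟨Tree.leaf x, rfl⟩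
  induction l with
  | nil => exact (hl rfl).elim
  | cons x l ih =>
    by_cases h : l = []
    · rw [h]
      exact hone x
    · obtain ⟨s, hs⟩ := hone x
      obtain ⟨t, ht⟩ := ih h
      cases k with
      | c => exact ⟨Tree.mulc s t, by simp [Tree.leaves, hs, ht]⟩
      | o => exact ⟨Tree.mulo s t, by simp [Tree.leaves, hs, ht]⟩

theorem omega_obj_surjective {X : Type} [Finite X] {χ : X → Col} {k : Col} :
    Function.Surjective fun u : MagMag.Op X χ k => omega.obj u := by
  intro l
  obtain ⟨t, ht⟩ := exists_tree_leaves l.2.2.1 l.2.2.2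
  exact ⟨⟨t, ht ▸ l.2.1⟩, Subtype.ext ht⟩

theorem separated_magToSC {X : Type} [Finite X] {χ : X → Col} {k : Col} (u : MagMag.Op X χ k) :
    Separated χ k (omegaOb.obj u).1 (magToSC.obj u).as.1 :=
  ⟨(magToSC.obj u).as.2, u.1.disk_leftOf u.2.1⟩

/-! ### Pullbacks and equivalences -/

theorem GrpdOperad.isCategoricalEquivalence_pullbackProj (P : GrpdOperad) {O : SetOperad}
    (F : O.Hom P.toSetOperad)
    (hF : ∀ (X : Type) [Finite X] (χ : X → Col) (k : Col) (p : P.Op X χ k),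
      ∃ u : O.Op X χ k, Nonempty (F.obj u ⟶ p)) :
    (P.pullbackProj F).IsCategoricalEquivalence := by
  intro X _ χ k
  exact
    { faithful := ⟨fun h => h⟩
      full := ⟨fun f => ⟨f, rfl⟩⟩
      essSurj := ⟨fun p => by
        obtain ⟨u, ⟨f⟩⟩ := hF X χ k p
        exact ⟨u, ⟨(Groupoid.isoEquivHom (F.obj u) p).symm f⟩⟩⟩ }

theorem GrpdOperad.Hom.mk_map_congr {P Q : GrpdOperad} (F : P.Hom Q) {X : Type} [Finite X]
    {χ : X → Col} {k : Col} {p p' q q' : P.Op X χ k} {f : p ⟶ p'} {g : q ⟶ q'}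
    (h : Arrow.mk f = Arrow.mk g) : Arrow.mk (F.map f) = Arrow.mk (F.map g) := by
  obtain ⟨rfl, rfl, h⟩ := mk_eq_mk.1 h
  rw [eq_of_heq h]

/-- The isomorphism given by a morphism of operads in groupoids that is bijective on objects and on
morphisms. -/
noncomputable def GrpdOperad.Hom.isoOfBijective {P Q : GrpdOperad} (F : P.Hom Q)
    (hobj : ∀ (X : Type) [Finite X] (χ : X → Col) (k : Col),
      Function.Bijective fun p : P.Op X χ k => F.obj p)
    (hmap : ∀ (X : Type) [Finite X] (χ : X → Col) (k : Col) (p p' : P.Op X χ k),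
      Function.Bijective fun f : p ⟶ p' => F.map f) : GrpdOperad.Iso P Q :=
  -- the inverse on objects and on morphisms; the laws hold because they do after applying `F`
  let G {X : Type} [Finite X] {χ : X → Col} {k : Col} : Q.Op X χ k → P.Op X χ k :=
    Function.surjInv (hobj X χ k).2
  have FG {X : Type} [Finite X] {χ : X → Col} {k : Col} (q : Q.Op X χ k) : F.obj (G q) = q :=
    Function.surjInv_eq (hobj X χ k).2 q
  have inj {X : Type} [Finite X] {χ : X → Col} {k : Col} {p p' s s' : P.Op X χ k} {f : p ⟶ p'}
      {g : s ⟶ s'} (h : Arrow.mk (F.map f) = Arrow.mk (F.map g)) : Arrow.mk f = Arrow.mk g := by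
    obtain ⟨h1, h2, h3⟩ := mk_eq_mk.1 h
    obtain rfl := (hobj X χ k).1 h1
    obtain rfl := (hobj X χ k).1 h2
    rw [(hmap X χ k p p').1 (eq_of_heq h3)]
  let Gm {X : Type} [Finite X] {χ : X → Col} {k : Col} {q q' : Q.Op X χ k} (g : q ⟶ q') :
      G q ⟶ G q' := Function.surjInv (hmap X χ k (G q) (G q')).2 (castHom (FG q) (FG q') g)
  have FGm {X : Type} [Finite X] {χ : X → Col} {k : Col} {q q' : Q.Op X χ k} (g : q ⟶ q') :
      Arrow.mk (F.map (Gm g)) = Arrow.mk g :=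
    (congrArg Arrow.mk (Function.surjInv_eq (hmap X χ k (G q) (G q')).2
      (castHom (FG q) (FG q') g))).trans (mk_castHom (FG q) (FG q') g)
  { hom := F
    inv :=
      { obj := G
        obj_relabel {_ X'} _ _ e χ k q := (hobj X' χ k).1 <|
          (FG _).trans ((F.obj_relabel e _).trans (congrArg (Q.relabel e) (FG q))).symm
        obj_one k := (hobj Unit _ k).1 ((FG _).trans (F.obj_one k).symm)
        obj_comp p q := (hobj _ _ _).1 <| (FG _).trans <| ((F.obj_comp _ _).trans
          (congrArg₂ (fun a b => Q.comp a b) (FG p) (funext fun y => FG (q y)))).symm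
        map := Gm
        map_id q := (Arrow.mk_inj _ _).1 <| inj <| (FGm _).trans <|
          ((congrArg Arrow.mk (F.map_id _)).trans (congrArg (fun a => Arrow.mk (𝟙 a)) (FG q))).symm
        map_comp {X} _ χ k q q' q'' f g := (hmap X χ k _ _).1 <| by
          have h1 : F.map (Gm (f ≫ g)) = castHom (FG q) (FG q'') (f ≫ g) :=
            Function.surjInv_eq (hmap X χ k _ _).2 _
          have h2 : F.map (Gm f) = castHom (FG q) (FG q') f :=
            Function.surjInv_eq (hmap X χ k _ _).2 _
          have h3 : F.map (Gm g) = castHom (FG q') (FG q'') g :=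
            Function.surjInv_eq (hmap X χ k _ _).2 _
          change F.map (Gm (f ≫ g)) = F.map (Gm f ≫ Gm g)
          rw [F.map_comp, h1, h2, h3, castHom_comp]
        map_relabel e _ _ _ _ f := inj <| (FGm _).trans <|
          ((F.map_relabel e _).trans (Q.relabelMap_congr e (FGm f))).symm
        map_compMap f g := inj <| (FGm _).trans <|
          ((F.map_compMap _ _).trans (Q.compMap_congr (FGm f) fun y => FGm (g y))).symm }
    hom_inv f := inj (FGm _)
    inv_hom g := FGm g }

/-! ### Paths to base configurations -/

section Shear

variable {X : Type} {χ : X → Col} {k : Col}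

/-- The affine interpolation between a configuration `z` and its image under halving followed by the
horizontal shear of slope `ε` stays in the configuration space: at each time it applies to the
points an upper triangular map with positive diagonal entries. -/
theorem isConf_shear {z : X → ℂ} (hz : IsConf χ k z) {ε : ℝ} (hε : 0 ≤ ε) (hε' : ε ≤ 1) {t : ℝ}
    (ht : 0 ≤ t) (ht' : t ≤ 1) :
    IsConf χ k (AffineMap.lineMap z (fun x => (z x + ε * (z x).im) / 2) t) := by
  have hre (x : X) : (AffineMap.lineMap z (fun x => (z x + ε * (z x).im) / 2) t x : ℂ).re =
      (1 - t / 2) * (z x).re + t * ε / 2 * (z x).im := by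
    simp [AffineMap.lineMap_apply_module]
    ring
  have him (x : X) : (AffineMap.lineMap z (fun x => (z x + ε * (z x).im) / 2) t x : ℂ).im =
      (1 - t / 2) * (z x).im := by
    simp [AffineMap.lineMap_apply_module]
    ring
  have h0 : 0 < 1 - t / 2 := by linarith
  refine ⟨hz.nonempty, fun x => ?_, fun x y h => ?_, hz.closed, fun hk x hx => ?_,
    fun hk x hx => ?_⟩
  · have h1 := hz.norm_le x
    have h2 : ‖(z x + ε * (z x).im) / 2‖ ≤ 1 := by
      rw [norm_div, Complex.norm_ofNat, div_le_one two_pos]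
      refine (norm_add_le _ _).trans ?_
      rw [norm_mul, Complex.norm_real, Complex.norm_real, Real.norm_of_nonneg hε, Real.norm_eq_abs]
      have h3 := Complex.abs_im_le_norm (z x)
      nlinarith [abs_nonneg (z x).im]
    have h3 := (convex_closedBall (0 : ℂ) 1).lineMap_mem (mem_closedBall_zero_iff.2 h1)
      (mem_closedBall_zero_iff.2 h2) ⟨ht, ht'⟩
    have h4 := mem_closedBall_zero_iff.1 h3
    rwa [AffineMap.lineMap_apply_module] at h4 ⊢
  · have h1 := congrArg Complex.im h
    have h2 := congrArg Complex.re h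
    rw [him, him] at h1
    have h3 := mul_left_cancel₀ h0.ne' h1
    rw [hre, hre, h3] at h2
    exact hz.inj (Complex.ext (mul_left_cancel₀ h0.ne' (add_right_cancel h2)) h3)
  · rw [him, hz.terr hk x hx, mul_zero]
  · rw [him]
    exact mul_pos h0 (hz.aer hk x hx)

/-- For all but finitely many slopes, a shear of distinct points has distinct abscissas. -/
theorem exists_shear_re_injective [Finite X] {z : X → ℂ} (hz : Function.Injective z) :
    ∃ ε : ℝ, 0 ≤ ε ∧ ε ≤ 1 ∧ Function.Injective fun x => (z x).re + ε * (z x).im := by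
  -- the slopes at which the shears of `z x` and `z y` have the same abscissa
  have hfin : (⋃ p : X × X,
      {ε : ℝ | ε = -((z p.1).re - (z p.2).re) / ((z p.1).im - (z p.2).im)}).Finite :=
    Set.finite_iUnion fun _ => Set.finite_singleton _
  obtain ⟨ε, hε, hn⟩ := ((Set.Icc_infinite (zero_lt_one (α := ℝ))).sdiff hfin).nonempty
  refine ⟨ε, hε.1, hε.2, fun x y h => ?_⟩
  have h : (z x).re + ε * (z x).im = (z y).re + ε * (z y).im := h
  by_cases h' : (z x).im = (z y).im
  · rw [h'] at h
    exact hz (Complex.ext (add_right_cancel h) h')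
  · refine (hn (Set.mem_iUnion.2 ⟨(x, y), ?_⟩)).elim
    change ε = _
    rw [eq_div_iff (sub_ne_zero.2 h')]
    linarith

theorem exists_order [Finite X] {r : X → ℝ} (hr : Function.Injective r) :
    ∃ l : List X, IsOrder l ∧ l.Pairwise fun x y => r x < r y := by
  let _ := Fintype.ofFinite X
  let _ : LinearOrder X := LinearOrder.lift' r hr
  exact ⟨Finset.univ.sort (· ≤ ·), ⟨Finset.sort_nodup _ _, fun x => by simp⟩,
    (Finset.sortedLT_sort Finset.univ).pairwise⟩

/-- The configuration space is the union of the path components of the base configurations. -/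
theorem exists_hom_base [Finite X] (z : ConfSpace X χ k) :
    ∃ l : Ord.Op X χ k, Nonempty (FundamentalGroupoid.mk (base l) ⟶ FundamentalGroupoid.mk z) := by
  obtain ⟨ε, h0, h1, hinj⟩ := exists_shear_re_injective z.2.inj
  obtain ⟨l, hl, hlt⟩ := exists_order hinj
  have hne : l ≠ [] := by
    obtain ⟨x⟩ := z.2.nonempty
    exact List.ne_nil_of_mem (hl.2 x)
  let lo : Ord.Op X χ k := ⟨l, hl, hne, z.2.closed⟩
  let w : ConfSpace X χ k := ⟨fun x => (z.1 x + ε * (z.1 x).im) / 2, by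
    simpa using isConf_shear z.2 h0 h1 zero_le_one le_rfl⟩
  have hw : InOrder χ k lo.1 w.1 := by
    refine ⟨w.2, hlt.imp fun {x y} h => ?_⟩
    have hre (x : X) : (w.1 x).re = ((z.1 x).re + ε * (z.1 x).im) / 2 := by
      simp [w]
    rw [hre, hre]
    linarith
  let p : Path z w :=
    { toFun := fun t => ⟨AffineMap.lineMap z.1 w.1 (t : ℝ), isConf_shear z.2 h0 h1 t.2.1 t.2.2⟩
      continuous_toFun := by
        refine Continuous.subtype_mk ?_ _
        simp only [AffineMap.lineMap_apply_module]
        fun_prop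
      source' := Subtype.ext (by simp)
      target' := Subtype.ext (by simp) }
  exact ⟨lo, ⟨straight lo (base_inOrder lo) hw ≫ pathHom p.symm⟩⟩

end Shear

theorem exists_hom_magToSC {X : Type} [Finite X] {χ : X → Col} {k : Col} (d : SCSpace X χ k) :
    ∃ u : MagMag.Op X χ k,
      Nonempty ((magToSC.obj u : SC.pi.Op X χ k) ⟶ FundamentalGroupoid.mk d) := by
  obtain ⟨l, ⟨f⟩⟩ := exists_hom_base (centres X χ k d)
  obtain ⟨u, rfl⟩ := omega_obj_surjective l
  exact ⟨u, ⟨straightS (omegaOb.obj u) (separated_magToSC u) (thickBase_separated _) ≫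
    thickenMap f ≫ pathS d⟩⟩

theorem piSCMagIncl_isCategoricalEquivalence : piSCMagIncl.IsCategoricalEquivalence :=
  SC.pi.isCategoricalEquivalence_pullbackProj _ fun _ _ _ _ d => by
    obtain ⟨u, h⟩ := exists_hom_magToSC d.as
    exact ⟨⟨magToSC.obj u, u, rfl⟩, h⟩

theorem papbToCopb_isCategoricalEquivalence : papbToCopb.IsCategoricalEquivalence :=
  CoPB.isCategoricalEquivalence_pullbackProj _ fun _ _ _ _ l => by
    obtain ⟨u, rfl⟩ := omega_obj_surjective l
    exact ⟨u, ⟨𝟙 _⟩⟩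

/-! ### Braids of paths of disks -/

section Braids

variable {X : Type} [Finite X] {χ : X → Col} {k : Col}

/-- The centre and thickening maps are homotopy inverse, so that a path of configurations of disks
is determined by its braid, and every braid arises. -/
theorem braidOf_bijective (l m : Ord.Op X χ k) {d e : SCSpace X χ k} (hd : Separated χ k l.1 d.1)
    (he : Separated χ k m.1 e.1) :
    Function.Bijective fun u : FundamentalGroupoid.mk d ⟶ FundamentalGroupoid.mk e =>
      braidOf l m hd he u := by
  have hiso (l : Ord.Op X χ k) {d e : SCSpace X χ k} (hd : Separated χ k l.1 d.1)
      (he : Separated χ k l.1 e.1) : straightS l hd he ≫ straightS l he hd = 𝟙 _ :=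
    (straightS_comp l _ _ _).trans (straightS_self l _)
  refine ⟨fun u v h => ?_, fun f => ?_⟩
  · have h1 := congrArg thickenMap h
    simp only [thicken_braidOf] at h1
    have h2 := congrArg (fun a => straightS l hd (thickBase_separated l) ≫ a ≫
      straightS m (thickBase_separated m) he) h1
    have h3 (u : FundamentalGroupoid.mk d ⟶ FundamentalGroupoid.mk e) :
        straightS l hd (thickBase_separated l) ≫ (straightS l (thickBase_separated l) hd ≫ u ≫
          straightS m he (thickBase_separated m)) ≫ straightS m (thickBase_separated m) he = u := by
      simp only [Category.assoc, hiso, Category.comp_id]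
      rw [← Category.assoc, hiso, Category.id_comp]
    exact (h3 u).symm.trans (h2.trans (h3 v))
  · exact ⟨straightS l hd (thickBase_separated l) ≫ thickenMap f ≫
      straightS m (thickBase_separated m) he,
      (braidOf_insert l m _ _ hd he (thickenMap f)).trans (braidOf_thicken f)⟩

/-- The tree of a configuration in the image of the free operad. -/
noncomputable def treeOf (p : piSCMag.Op X χ k) : MagMag.Op X χ k := p.2.choose

theorem magToSC_treeOf (p : piSCMag.Op X χ k) : magToSC.obj (treeOf p) = p.1 := p.2.choose_spec

theorem treeOf_eq (p : piSCMag.Op X χ k) (u : MagMag.Op X χ k) (h : magToSC.obj u = p.1) :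
    treeOf p = u :=
  magToSC_obj_injective ((magToSC_treeOf p).trans h.symm)

theorem separated_treeOf (p : piSCMag.Op X χ k) :
    Separated χ k (omegaOb.obj (treeOf p)).1 p.1.as.1 := by
  rw [← magToSC_treeOf p]
  exact separated_magToSC (treeOf p)

/-- The braid of a path between configurations in the image of the free operad. -/
noncomputable def treeBraid {p p' : piSCMag.Op X χ k} (f : p ⟶ p') :
    Braid (omegaOb.obj (treeOf p)) (omegaOb.obj (treeOf p')) :=
  braidOf (d := p.1.as) (e := p'.1.as) _ _ (separated_treeOf p) (separated_treeOf p') f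

end Braids

theorem treeOf_relabel {X X' : Type} [Finite X] [Finite X'] (e : X ≃ X') {χ : X' → Col} {k : Col}
    (p : piSCMag.Op X (χ ∘ e) k) :
    treeOf (piSCMag.relabel e p) = MagMag.relabel e (treeOf p) :=
  treeOf_eq _ _ <| (magToSC.obj_relabel e _).trans (congrArg (SC.pi.relabel e) (magToSC_treeOf p))

theorem treeOf_comp {Y : Type} [Finite Y] {X : Y → Type} [∀ y, Finite (X y)] {χ : Y → Col}
    {ξ : ∀ y, X y → Col} {k : Col} (p : piSCMag.Op Y χ k)
    (q : ∀ y, piSCMag.Op (X y) (ξ y) (χ y)) :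
    treeOf (piSCMag.comp p q) = MagMag.comp (treeOf p) fun y => treeOf (q y) :=
  treeOf_eq _ _ <| (magToSC.obj_comp _ _).trans
    (congrArg₂ (fun a b => SC.pi.comp a b) (magToSC_treeOf p)
      (funext fun y => magToSC_treeOf (q y)))

/-- The morphism `π SC|ΩΩ → PaPB`: configurations are sent to their trees and paths to braids. -/
noncomputable def piSCMagToPaPB : piSCMag.Hom PaPB where
  obj p := treeOf p
  obj_relabel e _ _ p := treeOf_relabel e p
  obj_one k := treeOf_eq _ _ (magToSC.obj_one k)
  obj_comp p q := treeOf_comp p q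
  map f := treeBraid f
  map_id p := braidOf_id _ (separated_treeOf p)
  map_comp f g := braidOf_trans _ _ _ _ _ _ _ _
  map_relabel {X X'} _ _ e χ k p p' f := by
    have h (p : piSCMag.Op X (χ ∘ e) k) : omegaOb.obj (treeOf (piSCMag.relabel e p)) =
        Ord.relabel e (omegaOb.obj (treeOf p)) :=
      (congrArg omegaOb.obj (treeOf_relabel e p)).trans (omegaOb.obj_relabel e _)
    refine CoPB.pullback_mk_eq omega ?_ (treeOf_relabel e p) (treeOf_relabel e p')
    refine Eq.trans ?_ (mk_castHom (C := CoPB.Op X' χ k) (omega.obj_relabel e (treeOf p))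
      (omega.obj_relabel e (treeOf p')) _).symm
    refine Eq.trans ?_ (congrArg mkB (braidRelabel_braidOf e _ _ (separated_treeOf p)
      (separated_treeOf p') f)).symm
    exact mkB_congr (h p) (h p') (mk_castHom (C := SC.pi.Op X' χ k)
      (magToSC.imageIncl.obj_relabel e p) (magToSC.imageIncl.obj_relabel e p') _)
  map_compMap {Y} _ {X} _ {χ ξ k} p p' q q' f g := by
    have h (p : piSCMag.Op Y χ k) (q : ∀ y, piSCMag.Op (X y) (ξ y) (χ y)) :
        omegaOb.obj (treeOf (piSCMag.comp p q)) =
          Ord.comp (omegaOb.obj (treeOf p)) fun y => omegaOb.obj (treeOf (q y)) :=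
      (congrArg omegaOb.obj (treeOf_comp p q)).trans (omegaOb.obj_comp _ _)
    refine CoPB.pullback_mk_eq omega ?_ (treeOf_comp p q) (treeOf_comp p' q')
    refine Eq.trans ?_ (mk_castHom (C := CoPB.Op (Σ y, X y) (fun w => ξ w.1 w.2) k)
      (omega.obj_comp (treeOf p) fun y => treeOf (q y))
      (omega.obj_comp (treeOf p') fun y => treeOf (q' y)) _).symm
    refine Eq.trans ?_ (congrArg mkB (braidComp_braidOf _ _ _ _ (separated_treeOf p)
      (fun y => separated_treeOf (q y)) (separated_treeOf p') (fun y => separated_treeOf (q' y))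
      f g)).symm
    exact mkB_congr (h p q) (h p' q')
      (mk_castHom (C := SC.pi.Op (Σ y, X y) (fun w => ξ w.1 w.2) k)
        (magToSC.imageIncl.obj_comp p q) (magToSC.imageIncl.obj_comp p' q') _)

end SwissCheese

theorem theorem3 :
    (∀ (X : Type) [Finite X] (χ : X → SwissCheese.Col) (k : SwissCheese.Col),
      Function.Injective fun u : SwissCheese.MagMag.Op X χ k => SwissCheese.magToSC.obj u) ∧
    SwissCheese.piSCMagIncl.IsCategoricalEquivalence ∧
    (∃ φ : SwissCheese.GrpdOperad.Iso SwissCheese.piSCMag SwissCheese.PaPB,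
      ∀ (X : Type) [Finite X] (χ : X → SwissCheese.Col) (k : SwissCheese.Col)
        (u : SwissCheese.MagMag.Op X χ k), φ.hom.obj ⟨SwissCheese.magToSC.obj u, u, rfl⟩ = u) ∧
    SwissCheese.papbToCopb.IsCategoricalEquivalence := by
  refine ⟨fun X _ χ k => SwissCheese.magToSC_obj_injective,
    SwissCheese.piSCMagIncl_isCategoricalEquivalence,
    ⟨SwissCheese.piSCMagToPaPB.isoOfBijective (fun X _ χ k => ⟨fun p q h => ?_, fun u => ?_⟩)
      fun X _ χ k p p' => SwissCheese.braidOf_bijective _ _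
        (SwissCheese.separated_treeOf p) (SwissCheese.separated_treeOf p'),
      fun X _ χ k u => SwissCheese.treeOf_eq _ u rfl⟩,
    SwissCheese.papbToCopb_isCategoricalEquivalence⟩
  · exact Subtype.ext <| (SwissCheese.magToSC_treeOf p).symm.trans <|
      (congrArg SwissCheese.magToSC.obj h).trans (SwissCheese.magToSC_treeOf q)
  · exact ⟨⟨SwissCheese.magToSC.obj u, u, rfl⟩, SwissCheese.treeOf_eq _ u rfl⟩
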